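/- Let $1\le N<K$ be integers and $0<M\le N$. A server holds $N$ independent files $W_1,\dots,W_N$, each uniformly distributed over $\{0,1\}^F$. Each of $K$ users has a cache of $\lfloor FM\rfloor$ bits and, after the caches have been filled, requests one file; user $k$ requests $W_{d_k}$. The server then sends a common message of $\lfloor FR\rfloor$ bits, and every user must recover its requested file from its cache and the message. A choice of caching, delivery and decoding functions for this is an $(M,R,F)$ code; its error probability is $\max_{d_1,\dots,d_K}\Pr\{\text{some user fails to recover its file}\}$. The group-based decentralized (GBD) scheme is the following random code, whose realization is known to the server and to the users during delivery. Placement: each user caches a uniformly random set of $\lfloor MF/N\rfloor$ bits of each file, independently over users and files. For $V\subseteq\{1,\dots,K\}$ let $W_{i,V}$ denote the bits of $W_i$ cached by exactly the users in $V$, and let $G_i=\{k : d_k=i\}$. Exclusive ors are zero-padded to the length of the longest argument. Coded delivery: the server sends 1. $W_{i,\emptyset}$ for every requested file $W_i$; 2. $W_{i,\{k\}}\oplus W_{i,\{k'\}}$ for every requested file $W_i$ and any two consecutive users $k,k'$ of $G_i$; and for any two requested files $W_i,W_j$ with $i<j$: $W_{i,\{k\}}\oplus W_{i,\{k'\}}$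 for consecutive users $k,k'$ of $G_j$, $W_{j,\{k\}}\oplus W_{j,\{k'\}}$ for consecutive users $k,k'$ of $G_i$, and $W_{i,\{\max G_j\}}\oplus W_{j,\{\max G_i\}}$; 3. $\bigoplus_{u\in U}W_{d_u,\,U\setminus\{u\}}$ for every set $U$ of at least three users. Random delivery: for each requested file, the server sends uniformly random linear combinations over $\mathbb{F}_2$ of its bits, just as many as are enough for all users requesting the file to decode it with the help of their caches (but no more than $\lfloor FR\rfloor$ per file). The server follows the procedure with the shorter transmission; what does not fit into $\lfloor FR\rfloor$ bits is lost. Theorem. The GBD scheme achieves the delivery rate $$R_{\mathrm{GBD}}(M)=\Big(1-\frac MN\Big)\min\Big\{\frac NM-\Big[(K-N-2)\Big(1+\tfrac12(K-N-1)\frac MN\Big)+\frac NM\Big]\Big(1-\frac MN\Big)^{K-2},\ N\Big\},$$ that is, for every $R>R_{\mathrm{GBD}}(M)$ the error probability of the scheme at rate $R$, averaged over the randomness of the scheme, tends to $0$ as $F\to\infty$. In particular, for every $R>R_{\mathrm{GBD}}(M)$ and every $\varepsilon>0$ there is, for all sufficiently large $F$, an $(M,R,F)$ code with error probability less than $\varepsilon$.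 -/

import Mathlib

open Filter Topology

noncomputable section

namespace CodedCaching

/-- A bit; the exclusive or of bits is addition modulo `2`. -/
abbrev Bit : Type := ZMod 2

/-- A database of `N` files, each of length `F` bits. -/
abbrev Database (N F : ℕ) : Type := Fin N → Fin F → Bit

/-- A demand vector: user `k` requests the file with index `d k`. -/
abbrev Demand (N K : ℕ) : Type := Fin K → Fin N

/-- Probability of an event under the uniform distribution on a finite sample space. -/
def uniformProb {Ω : Type} [Fintype Ω] (E : Set Ω) : ℝ :=
  (Nat.card E : ℝ) / (Fintype.card Ω : ℝ)

/-- Expectation of a random variable under the uniform distribution on a finite sample space. -/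
def uniformExp {Ω : Type} [Fintype Ω] (f : Ω → ℝ) : ℝ :=
  (∑ ω, f ω) / (Fintype.card Ω : ℝ)

/-! ### Caching and delivery codes -/

/-- A caching and delivery code for `N` files of `F` bits and `K` users, with caches of `m` bits
and a common message of `r` bits. -/
structure Code (N K F m r : ℕ) where
  /-- the cache content of user `k`, as a function of the database -/
  cache : Fin K → Database N F → (Fin m → Bit)
  /-- the common message, as a function of the database and the demands -/
  deliver : Database N F → Demand N K → (Fin r → Bit)
  /-- the reconstruction at user `k` from its cache, the common message and the demands -/
  decode : Fin K → (Fin m → Bit) → (Fin r → Bit) → Demand N K → (Fin F → Bit)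

/-- The event (a set of databases) that some user fails to recover its requested file. -/
def Code.errorEvent {N K F m r : ℕ} (c : Code N K F m r) (d : Demand N K) :
    Set (Database N F) :=
  {W | ∃ k, c.decode k (c.cache k W) (c.deliver W d) d ≠ W (d k)}

/-- The probability of error: the files are independent and uniformly distributed, and the demands
are the worst ones. -/
def Code.errorProb {N K F m r : ℕ} (c : Code N K F m r) : ℝ :=
  ⨆ d : Demand N K, uniformProb (c.errorEvent d)

/-- An `(M, R, F)` code: `⌊F M⌋` bits of cache per user, a message of `⌊F R⌋` bits. -/
abbrev RateCode (N K F : ℕ) (M R : ℝ) : Type :=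
  Code N K F ⌊(F : ℝ) * M⌋₊ ⌊(F : ℝ) * R⌋₊

/-- Achievability of the pair `(M, R)`: for every `ε > 0` and every sufficiently large `F` there is
an `(M, R, F)` code whose probability of error is less than `ε`. -/
def Achievable (N K : ℕ) (M R : ℝ) : Prop :=
  ∀ ε : ℝ, 0 < ε → ∃ F₀ : ℕ, ∀ F : ℕ, F₀ ≤ F →
    ∃ c : RateCode N K F M R, c.errorProb < ε

/-- Write a list of bits into a block of `n` bits: it is padded by zeros if it is too short, and
what does not fit is lost. -/
def fit (n : ℕ) (l : List Bit) : Fin n → Bit := fun t => l.getD t 0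

/-- Zero-padded exclusive or of the lists `l v`, `v ∈ s`; its length is the length of the longest
argument. -/
def padXor {ι : Type} (s : Finset ι) (l : ι → List Bit) : List Bit :=
  List.ofFn fun t : Fin (s.sup fun v => (l v).length) => ∑ v ∈ s, (l v).getD t 0

/-- Zero-padded exclusive or of two lists. -/
def padXor₂ (a b : List Bit) : List Bit := padXor Finset.univ ![a, b]

/-! ### Placement -/

/-- A placement: for each user and each file, the set of the `q` positions of the file that the
user caches. The uniform distribution on this type says that the users choose `q` random bits of
each file independently of each other and independently for different files. -/
abbrev Placement (N K F q : ℕ) : Type :=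
  Fin K → Fin N → {s : Finset (Fin F) // s.card = q}

/-- The cached bits of a user who caches the positions `P i` of file `i`. -/
def cachedBits {N F q : ℕ} (P : Fin N → {s : Finset (Fin F) // s.card = q})
    (W : Database N F) : List Bit :=
  (List.finRange N).flatMap fun i =>
    ((List.finRange F).filter fun f => f ∈ (P i).1).map (W i)

/-- `W_{i,V}`: the bits of file `i` that are cached exactly by the users in `V`. -/
def subfile {N K F q : ℕ} (S : Placement N K F q) (W : Database N F) (i : Fin N)
    (V : Finset (Fin K)) : List Bit :=
  ((List.finRange F).filter fun f =>
    (Finset.univ.filter fun k : Fin K => f ∈ (S k i).1) = V).map (W i)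

/-! ### Delivery -/

/-- The files requested by at least one user. -/
def requested {N K : ℕ} (d : Demand N K) : List (Fin N) :=
  (List.finRange N).filter fun i => ∃ k, d k = i

/-- The group of the users who request file `i`, in increasing order. -/
def group {N K : ℕ} (d : Demand N K) (i : Fin N) : List (Fin K) :=
  (List.finRange K).filter fun k => d k = i

/-- `W_{i,{k}} ⊕ W_{i,{k'}}` for all pairs of consecutive users `k`, `k'` in the list `g`. -/
def chain {N K F q : ℕ} (S : Placement N K F q) (W : Database N F) (i : Fin N)
    (g : List (Fin K)) : List Bit :=
  (List.zipWith (fun k k' => padXor₂ (subfile S W i {k}) (subfile S W i {k'})) g g.tail).flatten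

/-- `W_{i,{b}} ⊕ W_{j,{a}}`, where `a` and `b` are the last users of the groups of the files
`i` and `j`. -/
def link {N K F q : ℕ} (S : Placement N K F q) (W : Database N F) (d : Demand N K)
    (i j : Fin N) : List Bit :=
  match (group d i).getLast?, (group d j).getLast? with
  | some a, some b => padXor₂ (subfile S W i {b}) (subfile S W j {a})
  | _, _ => []

/-- Part 1: the bits of the requested files that no user has cached. -/
def part1 {N K F q : ℕ} (S : Placement N K F q) (W : Database N F) (d : Demand N K) :
    List Bit :=
  (requested d).flatMap fun i => subfile S W i ∅

/-- Part 2: the group-based delivery of the bits cached by exactly one user, within each group and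
between any two groups. -/
def part2 {N K F q : ℕ} (S : Placement N K F q) (W : Database N F) (d : Demand N K) :
    List Bit :=
  ((requested d).flatMap fun i => chain S W i (group d i)) ++
  ((requested d).flatMap fun i =>
    ((requested d).filter fun j => i < j).flatMap fun j =>
      chain S W i (group d j) ++ chain S W j (group d i) ++ link S W d i j)

/-- Part 3: the bits cached by more than one user. For every set `U` of at least three users (the
set `V ∪ {i}`, where `i` is the smallest element and `V` has at least two elements), the exclusive
or of the subfiles `W_{d u, U \ {u}}`, `u ∈ U`. -/
def part3 {N K F q : ℕ} (S : Placement N K F q) (W : Database N F) (d : Demand N K) :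
    List Bit :=
  ((Finset.univ : Finset (Finset (Fin K))).filter fun U => 3 ≤ U.card).toList.flatMap fun U =>
    padXor U fun u => subfile S W (d u) (U.erase u)

/-- The coded delivery procedure. -/
def deliverCoded {N K F q : ℕ} (S : Placement N K F q) (W : Database N F) (d : Demand N K) :
    List Bit :=
  part1 S W d ++ part2 S W d ++ part3 S W d

/-- Coefficients of `r` linear combinations of the bits of each file. Under the uniform
distribution on this type they are independent and uniformly random. -/
abbrev Coefficients (N F r : ℕ) : Type := Fin N → Fin r → Fin F → Bit

/-- The first `t` linear combinations of the bits of file `i`, together with its cached bits,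
determine file `i` for every user who requests it. -/
def Enough {N K F q r : ℕ} (S : Placement N K F q) (A : Coefficients N F r) (d : Demand N K)
    (i : Fin N) (t : ℕ) : Prop :=
  ∀ k, d k = i → ∀ w w' : Fin F → Bit,
    (∀ f ∈ (S k i).1, w f = w' f) →
    (∀ s : Fin r, (s : ℕ) < t → A i s ⬝ᵥ w = A i s ⬝ᵥ w') → w = w'

/-- The number of linear combinations of file `i` that are sent: the least number that is enough,
or all `r` of them if no number is. -/
def numCombinations {N K F q r : ℕ} (S : Placement N K F q) (A : Coefficients N F r)
    (d : Demand N K) (i : Fin N) : ℕ :=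
  sInf {t | r ≤ t ∨ Enough S A d i t}

/-- The random delivery procedure: enough random linear combinations of each requested file. -/
def deliverRandom {N K F q r : ℕ} (S : Placement N K F q) (A : Coefficients N F r)
    (W : Database N F) (d : Demand N K) : List Bit :=
  (requested d).flatMap fun i =>
    ((List.finRange r).take (numCombinations S A d i)).map fun s => A i s ⬝ᵥ W i

/-- The server follows the procedure with the shorter transmission. The lengths depend on the
placement, the coefficients and the demands only, not on the contents of the files. -/
def deliverGBD {N K F q r : ℕ} (S : Placement N K F q) (A : Coefficients N F r)
    (W : Database N F) (d : Demand N K) : List Bit :=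
  if (deliverCoded S W d).length ≤ (deliverRandom S A W d).length then deliverCoded S W d
  else deliverRandom S A W d

/-! ### The GBD scheme as a random code -/

/-- The code given by a placement and a choice of coefficients. The cache content of a user
depends only on the positions which that user has drawn. Each user outputs its requested file from
a database that is consistent with its cache content and the common message. -/
def gbdCode {N K F q m r : ℕ} (S : Placement N K F q) (A : Coefficients N F r) :
    Code N K F m r where
  cache k W := fit m (cachedBits (S k) W)
  deliver W d := fit r (deliverGBD S A W d)
  decode k z x d :=
    open Classical in
    if h : ∃ W : Database N F,
        fit m (cachedBits (S k) W) = z ∧ fit r (deliverGBD S A W d) = x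
    then h.choose (d k) else 0

/-- The randomness of the scheme with parameters `M`, `R`, `F`: a uniformly random placement of
`⌊M F / N⌋` bits of each file at each user, and, independently of it, uniformly random coefficients
of `⌊F R⌋` linear combinations of each file (more could not be sent anyway). -/
abbrev GBDRandomness (N K F : ℕ) (M R : ℝ) : Type :=
  Placement N K F ⌊M * (F : ℝ) / (N : ℝ)⌋₊ × Coefficients N F ⌊(F : ℝ) * R⌋₊

/-- The random `(M, R, F)` code of the GBD scheme. -/
def gbdRateCode {N K F : ℕ} {M R : ℝ} (ω : GBDRandomness N K F M R) : RateCode N K F M R :=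
  gbdCode ω.1 ω.2

/-- The error probability of the random `(M, R, F)` code of the GBD scheme: the worst-case (over
the demands) probability of error, averaged over the randomness of the scheme. -/
def gbdErrorProb (N K F : ℕ) (M R : ℝ) : ℝ :=
  uniformExp fun ω : GBDRandomness N K F M R => (gbdRateCode ω).errorProb

/-- The GBD scheme achieves the delivery rate `R` at cache capacity `M` (asymptotically in the file
size): at any rate above `R`, its error probability tends to `0` as `F` tends to infinity. -/
def AchievedByGBD (N K : ℕ) (M R : ℝ) : Prop :=
  ∀ R' : ℝ, R < R' → Tendsto (fun F : ℕ => gbdErrorProb N K F M R') atTop (𝓝 0)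

/-- The claimed delivery rate of the GBD scheme. -/
def gbdRate (N K : ℕ) (M : ℝ) : ℝ :=
  (1 - M / N) *
    min ((N : ℝ) / M -
        (((K : ℝ) - N - 2) * (1 + 1 / 2 * ((K : ℝ) - N - 1) * (M / N)) + (N : ℝ) / M) *
          (1 - M / N) ^ (K - 2))
      (N : ℝ)

end CodedCaching

end

noncomputable section

namespace CodedCaching

/-! ### Finite uniform probability -/

section Probability

variable {Ω : Type} [Fintype Ω]

/-! Put `q = ⌊MF/N⌋` and `p = q/F`, so `p → M/N`. A fixed bit of a file is cached by exactly the
users in `V` with probability `p^|V| (1-p)^(K-|V|)`. Sampling without replacement makes the events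
for different positions negatively correlated, so the size of `W_{i,V}` has variance at most `F`.
Chebyshev and a union bound over the finitely many pairs `(i, V)` keep all subfiles below their mean
plus `εF` with probability tending to 1 (`uniformProb_not_typical`). Then the length of the coded
delivery follows by counting blocks (`length_deliverCoded_le`). The count increases with the number
of requested files (`codedBound_mono_left`), and for `N` files the binomial theorem turns it into
the first argument of the minimum (`codedBound_eq`).

For the random delivery, at most `2^(F-q)` nonzero vectors vanish on a given cache, and each is
annihilated by `F-q+e` random combinations with probability `2^-(F-q+e)`. So with `e = ⌊εF⌋` surplus
combinations every user can decode, up to probability `NK 2^-e` (`uniformProb_not_determined`); `N`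
files cost at most `N(F-q+e)` bits.

Correctness is a uniqueness statement: two databases that agree on the cache of user `k` and yield
the same full transmission agree on file `d k` (`eq_of_deliverGBD_eq`). Any consistent database
therefore serves the decoder. One trap remains: random delivery cut off at `⌊FR⌋` combinations per
file could be shorter than the coded one and yet undecodable. This needs `R > 1 - M/N` in every
case, which `one_sub_le_codedBound` supplies. -/

theorem uniformExp_mono {f g : Ω → ℝ} (h : ∀ ω, f ω ≤ g ω) : uniformExp f ≤ uniformExp g :=
  div_le_div_of_nonneg_right (Finset.sum_le_sum fun ω _ => h ω) (Nat.cast_nonneg _)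

theorem uniformExp_nonneg {f : Ω → ℝ} (h : ∀ ω, 0 ≤ f ω) : 0 ≤ uniformExp f :=
  div_nonneg (Finset.sum_nonneg fun ω _ => h ω) (Nat.cast_nonneg _)

theorem uniformExp_const [Nonempty Ω] (c : ℝ) : uniformExp (fun _ : Ω => c) = c := by
  simp [uniformExp]

theorem uniformExp_add (f g : Ω → ℝ) :
    uniformExp (fun ω => f ω + g ω) = uniformExp f + uniformExp g := by
  simp [uniformExp, Finset.sum_add_distrib, add_div]

theorem uniformExp_const_mul (c : ℝ) (f : Ω → ℝ) :
    uniformExp (fun ω => c * f ω) = c * uniformExp f := by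
  simp [uniformExp, ← Finset.mul_sum, mul_div_assoc]

theorem uniformExp_sum {ι : Type} (s : Finset ι) (f : ι → Ω → ℝ) :
    uniformExp (fun ω => ∑ i ∈ s, f i ω) = ∑ i ∈ s, uniformExp (f i) := by
  simp only [uniformExp]
  rw [Finset.sum_comm, Finset.sum_div]

theorem exists_le_uniformExp [Nonempty Ω] (f : Ω → ℝ) : ∃ ω, f ω ≤ uniformExp f := by
  by_contra! h
  have : ∑ ω : Ω, uniformExp f < ∑ ω, f ω :=
    Finset.sum_lt_sum_of_nonempty Finset.univ_nonempty fun ω _ => h ω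
  have hc : (0 : ℝ) < Fintype.card Ω := by exact_mod_cast Fintype.card_pos
  simp only [Finset.sum_const, Finset.card_univ, nsmul_eq_mul] at this
  rw [uniformExp, mul_div_cancel₀ _ hc.ne'] at this
  exact lt_irrefl _ this

theorem uniformExp_comp_equiv {Ω' : Type} [Fintype Ω'] (e : Ω ≃ Ω') (f : Ω' → ℝ) :
    uniformExp (fun ω => f (e ω)) = uniformExp f := by
  simp only [uniformExp]
  rw [Fintype.card_congr e, Equiv.sum_comp e f]

theorem uniformProb_eq_uniformExp (E : Set Ω) :
    uniformProb E = uniformExp (E.indicator fun _ => 1) := by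
  classical
  simp only [uniformProb, uniformExp, Set.indicator_apply, Finset.sum_boole]
  congr 2
  rw [Nat.card_eq_fintype_card, ← Set.toFinset_card]
  congr 1
  ext
  simp

theorem uniformProb_le_uniformExp {E : Set Ω} {f : Ω → ℝ} (h0 : ∀ ω, 0 ≤ f ω)
    (h1 : ∀ ω ∈ E, 1 ≤ f ω) : uniformProb E ≤ uniformExp f := by
  rw [uniformProb_eq_uniformExp]
  refine uniformExp_mono fun ω => ?_
  by_cases hω : ω ∈ E <;> simp [hω, h0, h1]

theorem uniformProb_nonneg (E : Set Ω) : 0 ≤ uniformProb E :=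
  div_nonneg (Nat.cast_nonneg _) (Nat.cast_nonneg _)

theorem uniformProb_mono {E E' : Set Ω} (h : E ⊆ E') : uniformProb E ≤ uniformProb E' := by
  simp only [uniformProb_eq_uniformExp]
  exact uniformExp_mono fun ω => Set.indicator_le_indicator_of_subset h (fun _ => zero_le_one) ω

theorem uniformProb_le_one (E : Set Ω) : uniformProb E ≤ 1 := by
  rw [uniformProb, ← Nat.card_eq_fintype_card]
  exact div_le_one_of_le₀ (by exact_mod_cast Finite.card_subtype_le _) (Nat.cast_nonneg _)

theorem uniformProb_empty : uniformProb (∅ : Set Ω) = 0 := by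
  simp [uniformProb]

theorem uniformProb_iUnion_le {ι : Type} [Fintype ι] (E : ι → Set Ω) :
    uniformProb (⋃ j, E j) ≤ ∑ j, uniformProb (E j) := by
  simp only [uniformProb_eq_uniformExp (E _), ← uniformExp_sum]
  have h0 : ∀ j ω, 0 ≤ (E j).indicator (fun _ => (1 : ℝ)) ω := fun j ω =>
    Set.indicator_nonneg (fun _ _ => zero_le_one) ω
  refine uniformProb_le_uniformExp (fun ω => Finset.sum_nonneg fun j _ => h0 j ω) fun ω hω => ?_
  obtain ⟨j, hj⟩ := Set.mem_iUnion.1 hω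
  calc (1 : ℝ) = (E j).indicator (fun _ => (1 : ℝ)) ω := by simp [hj]
    _ ≤ _ := Finset.single_le_sum (fun j _ => h0 j ω) (Finset.mem_univ j)

theorem uniformProb_union_le (E E' : Set Ω) :
    uniformProb (E ∪ E') ≤ uniformProb E + uniformProb E' := by
  simpa [Set.union_eq_iUnion] using uniformProb_iUnion_le fun b : Bool => cond b E E'

/-- Markov's inequality for `(X - μ)² / a²`. Only an upper bound `v` on the variance is needed,
since only the upper tail is estimated. -/
theorem uniformProb_chebyshev [Nonempty Ω] (X : Ω → ℝ) {μ v a : ℝ} (hμ : uniformExp X = μ)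
    (hv : uniformExp (fun ω => X ω ^ 2) ≤ μ ^ 2 + v) (ha : 0 < a) :
    uniformProb {ω | μ + a < X ω} ≤ v / a ^ 2 := by
  have key : uniformExp (fun ω => (1 / a ^ 2) * (X ω ^ 2 + ((-(2 * μ)) * X ω + μ ^ 2))) ≤
      v / a ^ 2 := by
    rw [uniformExp_const_mul, uniformExp_add, uniformExp_add, uniformExp_const_mul,
      uniformExp_const, hμ, div_eq_mul_one_div v, mul_comm v]
    exact mul_le_mul_of_nonneg_left (by linarith) (by positivity)
  refine (uniformProb_le_uniformExp (fun ω => ?_) fun ω hω => ?_).trans key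
  · have : X ω ^ 2 + ((-(2 * μ)) * X ω + μ ^ 2) = (X ω - μ) ^ 2 := by ring
    rw [this]
    positivity
  · have : X ω ^ 2 + ((-(2 * μ)) * X ω + μ ^ 2) = (X ω - μ) ^ 2 := by ring
    rw [this, one_div, inv_mul_eq_div, one_le_div (by positivity)]
    have : μ + a < X ω := hω
    exact pow_le_pow_left₀ ha.le (by linarith) 2

/-- Independence of the coordinates: the sum over the product space and its cardinality both factor.
-/
theorem uniformExp_pi {ι : Type} [Fintype ι] [DecidableEq ι] {α : ι → Type}
    [∀ i, Fintype (α i)] (f : ∀ i, α i → ℝ) :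
    uniformExp (fun x : ∀ i, α i => ∏ i, f i (x i)) = ∏ i, uniformExp (f i) := by
  simp only [uniformExp, Finset.prod_div_distrib, Finset.prod_univ_sum, Fintype.piFinset_univ,
    Fintype.card_pi, Nat.cast_prod]

theorem uniformExp_eval {ι α : Type} [Fintype ι] [DecidableEq ι] [Fintype α] [Nonempty α]
    (i : ι) (g : α → ℝ) : uniformExp (fun x : ι → α => g (x i)) = uniformExp g := by
  have := uniformExp_pi (α := fun _ : ι => α) fun j a => if j = i then g a else 1
  simp only [Finset.prod_ite_eq', Finset.mem_univ, if_true] at this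
  rw [this, ← Finset.mul_prod_erase _ _ (Finset.mem_univ i), Finset.prod_eq_one, mul_one]
  · simp
  · intro j hj
    simp [Finset.ne_of_mem_erase hj, uniformExp_const]

theorem uniformProb_preimage_fst {Ω' : Type} [Fintype Ω'] [Nonempty Ω'] (E : Set Ω) :
    uniformProb {ω : Ω × Ω' | ω.1 ∈ E} = uniformProb E := by
  have hc : (Fintype.card Ω' : ℝ) ≠ 0 := by exact_mod_cast Fintype.card_ne_zero
  simp only [uniformProb_eq_uniformExp, uniformExp, Fintype.sum_prod_type, Fintype.card_prod]
  change (∑ x : Ω, ∑ y : Ω', E.indicator (fun _ => (1 : ℝ)) x) / _ = _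
  simp only [Finset.sum_const, Finset.card_univ, nsmul_eq_mul, ← Finset.mul_sum, Nat.cast_mul]
  rw [mul_comm, mul_div_mul_right _ _ hc]

end Probability

/-! ### Uniformly random subsets of fixed size -/

section RandomSubset

variable {F q : ℕ}

theorem nonempty_subsets (hq : q ≤ F) : Nonempty {s : Finset (Fin F) // s.card = q} := by
  obtain ⟨s, -, hs⟩ := Finset.exists_subset_card_eq (s := (Finset.univ : Finset (Fin F))) (n := q)
    (by simpa using hq)
  exact ⟨⟨s, hs⟩⟩

/-- The indicator that the subset `s` contains `f`. -/
def memInd (f : Fin F) (s : {s : Finset (Fin F) // s.card = q}) : ℝ := if f ∈ s.1 then 1 else 0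

/-- A permutation of the positions permutes the subsets of size `q`. -/
def permSubsets (σ : Equiv.Perm (Fin F)) : Equiv.Perm {s : Finset (Fin F) // s.card = q} :=
  (Equiv.finsetCongr σ).subtypeEquiv fun s => by simp

theorem memInd_permSubsets (σ : Equiv.Perm (Fin F)) (f : Fin F)
    (s : {s : Finset (Fin F) // s.card = q}) :
    memInd (σ f) (permSubsets σ s) = memInd f s := by
  simp [memInd, permSubsets]

theorem sum_memInd (s : {s : Finset (Fin F) // s.card = q}) : ∑ f, memInd f s = q := by
  simp [memInd, s.2]

/-- Transpositions show that all positions are equally likely, and the `F` equal expectations add up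
to `q`. -/
theorem uniformExp_memInd (hq : q ≤ F) (f : Fin F) :
    uniformExp (memInd (q := q) f) = (q : ℝ) / F := by
  have := nonempty_subsets hq
  have hsymm : ∀ g, uniformExp (memInd (q := q) g) = uniformExp (memInd (q := q) f) := fun g => by
    rw [← uniformExp_comp_equiv (permSubsets (Equiv.swap f g)) (memInd g)]
    congr 1
    ext s
    have h := memInd_permSubsets (Equiv.swap f g) f s
    rwa [Equiv.swap_apply_left] at h
  have hsum : ∑ g : Fin F, uniformExp (memInd (q := q) g) = q := by
    rw [← uniformExp_sum]
    simp only [sum_memInd, uniformExp_const]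
  rw [Finset.sum_congr rfl fun g _ => hsymm g, Finset.sum_const, Finset.card_univ, Fintype.card_fin,
    nsmul_eq_mul] at hsum
  have hF : (F : ℝ) ≠ 0 := by
    have := f.pos
    positivity
  rw [eq_div_iff hF, mul_comm, hsum]

/-- Negative correlation. By symmetry all `g ≠ f` give the same value, and together they give `E[1_f
(q - 1_f)] = (q-1) q/F`. Each is thus `(q/F) (q-1)/(F-1)`, and `(q-1)/(F-1) ≤ q/F` because `q ≤ F`.
-/
theorem uniformExp_memInd_mul_le (hq : q ≤ F) {f g : Fin F} (hfg : f ≠ g) :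
    uniformExp (fun s => memInd (q := q) f s * memInd g s) ≤ ((q : ℝ) / F) ^ 2 := by
  have := nonempty_subsets hq
  have hsymm : ∀ g' ∈ Finset.univ.erase f,
      uniformExp (fun s => memInd (q := q) f s * memInd g' s) =
        uniformExp (fun s => memInd (q := q) f s * memInd g s) := fun g' hg' => by
    rw [← uniformExp_comp_equiv (permSubsets (Equiv.swap g g'))
      (fun s => memInd (q := q) f s * memInd g' s)]
    congr 1
    ext s
    congr 1
    · have h := memInd_permSubsets (Equiv.swap g g') f s
      rwa [Equiv.swap_apply_of_ne_of_ne hfg (Finset.ne_of_mem_erase hg').symm] at h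
    · have h := memInd_permSubsets (Equiv.swap g g') g s
      rwa [Equiv.swap_apply_left] at h
  have hsum : ∑ g' ∈ Finset.univ.erase f,
      uniformExp (fun s => memInd (q := q) f s * memInd g' s) = (q - 1) * (q / F) := by
    rw [← uniformExp_sum, ← uniformExp_memInd hq f, ← uniformExp_const_mul]
    congr 1
    ext s
    rw [← Finset.mul_sum, Finset.sum_erase_eq_sub (Finset.mem_univ f), sum_memInd]
    unfold memInd
    split_ifs <;> ring
  rw [Finset.sum_congr rfl hsymm, Finset.sum_const, Finset.card_erase_of_mem (Finset.mem_univ f),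
    Finset.card_univ, Fintype.card_fin, nsmul_eq_mul] at hsum
  have hF2 : 2 ≤ F := by
    by_contra h
    exact hfg (Fin.ext (by omega))
  have hF : (2 : ℝ) ≤ F := by exact_mod_cast hF2
  have hqF : (q : ℝ) ≤ F := by exact_mod_cast hq
  rw [Nat.cast_sub (by omega), Nat.cast_one] at hsum
  set b := uniformExp (fun s => memInd (q := q) f s * memInd g s)
  have hb : b = (q - 1) * (q / F) / (F - 1) := by
    rw [eq_div_iff (by linarith), mul_comm, hsum]
  rw [hb, div_le_iff₀ (by linarith), sq, mul_comm, mul_assoc]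
  refine mul_le_mul_of_nonneg_left ?_ (by positivity)
  rw [div_mul_eq_mul_div, le_div_iff₀ (by linarith)]
  nlinarith

/-- The indicator that membership of `f` in `s` is as prescribed by `b`. -/
def patInd (b : Prop) [Decidable b] (f : Fin F) (s : {s : Finset (Fin F) // s.card = q}) : ℝ :=
  if f ∈ s.1 ↔ b then 1 else 0

theorem patInd_eq (b : Prop) [Decidable b] (f : Fin F) (s : {s : Finset (Fin F) // s.card = q}) :
    patInd b f s = if b then memInd f s else 1 + (-1) * memInd f s := by
  by_cases hb : b <;> by_cases hf : f ∈ s.1 <;> simp [patInd, memInd, hb, hf]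

theorem uniformExp_patInd (hq : q ≤ F) (b : Prop) [Decidable b] (f : Fin F) :
    uniformExp (patInd (q := q) b f) = if b then (q : ℝ) / F else 1 - (q : ℝ) / F := by
  have := nonempty_subsets hq
  rw [show patInd (q := q) b f = _ from funext (patInd_eq b f)]
  by_cases hb : b <;> simp only [hb, if_true, if_false]
  · exact uniformExp_memInd hq f
  · rw [uniformExp_add, uniformExp_const, uniformExp_const_mul, uniformExp_memInd hq f]
    ring

/-- Complementing both indicators preserves their covariance, so the events of not being cached are
negatively correlated as well. -/
theorem uniformExp_patInd_mul_le (hq : q ≤ F) (b : Prop) [Decidable b] {f g : Fin F}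
    (hfg : f ≠ g) :
    uniformExp (fun s => patInd (q := q) b f s * patInd b g s) ≤
      (if b then (q : ℝ) / F else 1 - (q : ℝ) / F) ^ 2 := by
  have := nonempty_subsets hq
  simp only [patInd_eq]
  have h := uniformExp_memInd_mul_le hq hfg
  by_cases hb : b <;> simp only [hb, if_true, if_false]
  · exact h
  · have hexp : (fun s => (1 + -1 * memInd (q := q) f s) * (1 + -1 * memInd g s)) =
        fun s => 1 + (-1 * memInd f s + (-1 * memInd g s + memInd f s * memInd g s)) := by
      ext s
      ring
    rw [hexp, uniformExp_add, uniformExp_add, uniformExp_add, uniformExp_const,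
      uniformExp_const_mul, uniformExp_const_mul, uniformExp_memInd hq, uniformExp_memInd hq]
    linarith

end RandomSubset

/-! ### Sizes of the subfiles -/

section SubfileSize

variable {N K F q : ℕ}

/-- A sum over positions of products over users: linearity handles the sum, and independence of the
users factors the products. -/
theorem length_subfile_eq_sum (S : Placement N K F q) (W : Database N F) (i : Fin N)
    (V : Finset (Fin K)) :
    ((subfile S W i V).length : ℝ) = ∑ f, ∏ k, patInd (k ∈ V) f (S k i) := by
  have hprod : ∀ f, ∏ k, patInd (k ∈ V) f (S k i) =
      if (Finset.univ.filter fun k : Fin K => f ∈ (S k i).1) = V then 1 else 0 := fun f => by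
    simp only [patInd, Finset.prod_boole, Finset.ext_iff, Finset.mem_filter, Finset.mem_univ,
      true_and, forall_const]
  simp only [hprod, subfile, List.length_map]
  rw [Finset.sum_boole, ← List.toFinset_card_of_nodup ((List.nodup_finRange F).filter _)]
  congr 2
  ext f
  simp

/-- The probability that a given bit is cached exactly by the `v` users of a given set. -/
def subfileProb (K : ℕ) (p : ℝ) (v : ℕ) : ℝ := p ^ v * (1 - p) ^ (K - v)

theorem prod_ite_mem_eq_subfileProb (p : ℝ) (V : Finset (Fin K)) :
    ∏ k, (if k ∈ V then p else 1 - p) = subfileProb K p V.card := by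
  rw [Finset.prod_ite, Finset.prod_const, Finset.prod_const, subfileProb]
  have h1 : (Finset.univ.filter fun k => k ∈ V) = V := by ext; simp
  have h2 : (Finset.univ.filter fun k => k ∉ V) = Vᶜ := by ext; simp
  rw [h1, h2, Finset.card_compl, Fintype.card_fin]

theorem nonempty_placement (hq : q ≤ F) : Nonempty (Placement N K F q) := by
  have := nonempty_subsets hq
  infer_instance

theorem uniformExp_placement (hq : q ≤ F) (i : Fin N)
    (φ : Fin K → {s : Finset (Fin F) // s.card = q} → ℝ) :
    uniformExp (fun S : Placement N K F q => ∏ k, φ k (S k i)) = ∏ k, uniformExp (φ k) := by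
  have := nonempty_subsets hq
  rw [uniformExp_pi (α := fun _ : Fin K => Fin N → {s : Finset (Fin F) // s.card = q})
    fun k x => φ k (x i)]
  exact Finset.prod_congr rfl fun k _ => uniformExp_eval i (φ k)

theorem uniformExp_length_subfile (hq : q ≤ F) (W : Database N F) (i : Fin N)
    (V : Finset (Fin K)) :
    uniformExp (fun S : Placement N K F q => ((subfile S W i V).length : ℝ)) =
      F * subfileProb K ((q : ℝ) / F) V.card := by
  simp only [length_subfile_eq_sum]
  rw [uniformExp_sum]
  simp only [uniformExp_placement hq i fun k => patInd (k ∈ V) _, uniformExp_patInd hq,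
    prod_ite_mem_eq_subfileProb]
  simp

/-- The square expands into pairs of positions. Off the diagonal, negative correlation for each user
bounds the expectation by the square of the single-bit probability; each of the `F` diagonal terms
contributes at most 1 more. -/
theorem uniformExp_length_subfile_sq_le (hq : q ≤ F) (W : Database N F) (i : Fin N)
    (V : Finset (Fin K)) :
    uniformExp (fun S : Placement N K F q => ((subfile S W i V).length : ℝ) ^ 2) ≤
      (F * subfileProb K ((q : ℝ) / F) V.card) ^ 2 + F := by
  have : Nonempty (Placement N K F q) := nonempty_placement hq
  have h01 : ∀ (k : Fin K) (f : Fin F) s, 0 ≤ patInd (q := q) (k ∈ V) f s ∧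
      patInd (q := q) (k ∈ V) f s ≤ 1 := fun k f s => by
    unfold patInd
    split_ifs <;> norm_num
  simp only [length_subfile_eq_sum, sq (∑ f, _), Finset.sum_mul_sum, ← Finset.prod_mul_distrib]
  rw [uniformExp_sum]
  simp only [uniformExp_sum]
  have hprod := fun f g : Fin F => uniformExp_placement hq i fun k s =>
    patInd (k ∈ V) f s * patInd (k ∈ V) g s
  simp only [hprod]
  set m := subfileProb K ((q : ℝ) / F) V.card with hm
  have hle : ∀ f g : Fin F, ∏ k, uniformExp (fun s => patInd (q := q) (k ∈ V) f s *
      patInd (k ∈ V) g s) ≤ m ^ 2 + if f = g then 1 else 0 := fun f g => by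
    have := nonempty_subsets hq
    have h0 : ∀ k, 0 ≤ uniformExp (fun s => patInd (q := q) (k ∈ V) f s * patInd (k ∈ V) g s) :=
      fun k => uniformExp_nonneg fun s => mul_nonneg (h01 k f s).1 (h01 k g s).1
    by_cases hfg : f = g
    · rw [if_pos hfg]
      have : ∏ k, uniformExp (fun s => patInd (q := q) (k ∈ V) f s * patInd (k ∈ V) g s) ≤ 1 := by
        refine Finset.prod_le_one (fun k _ => h0 k) fun k _ => ?_
        refine (uniformExp_mono fun s => ?_).trans_eq (uniformExp_const 1)
        exact mul_le_one₀ (h01 k f s).2 (h01 k g s).1 (h01 k g s).2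
      nlinarith [sq_nonneg m]
    · rw [if_neg hfg, add_zero, hm, ← prod_ite_mem_eq_subfileProb, ← Finset.prod_pow]
      exact Finset.prod_le_prod (fun k _ => h0 k) fun k _ => uniformExp_patInd_mul_le hq _ hfg
  refine (Finset.sum_le_sum fun f _ => Finset.sum_le_sum fun g _ => hle f g).trans_eq ?_
  simp only [Finset.sum_add_distrib, Finset.sum_ite_eq, Finset.mem_univ, if_true,
    Finset.sum_const, Finset.card_univ, Fintype.card_fin, nsmul_eq_mul]
  ring

theorem uniformProb_length_subfile_gt (hq : q ≤ F) (W : Database N F) (i : Fin N)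
    (V : Finset (Fin K)) {ε : ℝ} (hε : 0 < ε) (hF : 0 < F) :
    uniformProb {S : Placement N K F q |
        F * subfileProb K ((q : ℝ) / F) V.card + ε * F < (subfile S W i V).length} ≤
      1 / (ε ^ 2 * F) := by
  have : Nonempty (Placement N K F q) := nonempty_placement hq
  have hF' : (0 : ℝ) < F := by exact_mod_cast hF
  refine (uniformProb_chebyshev _ (uniformExp_length_subfile hq W i V)
    (uniformExp_length_subfile_sq_le hq W i V) (by positivity)).trans_eq ?_
  field_simp

end SubfileSize

/-! ### Random linear combinations -/

section RandomCombinations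

variable {N F r : ℕ}

/-- Flipping the coordinate of `a` at a position where `v` is 1 is a bijection that exchanges the
two values of `a ⬝ᵥ v`. -/
theorem uniformExp_dotProduct_eq_zero {v : Fin F → Bit} (hv : v ≠ 0) :
    uniformExp (fun a : Fin F → Bit => if a ⬝ᵥ v = 0 then (1 : ℝ) else 0) = 1 / 2 := by
  obtain ⟨f, hf⟩ := Function.ne_iff.1 hv
  have hf1 : v f = 1 := by
    have : ∀ x : Bit, x ≠ 0 → x = 1 := by decide
    exact this _ hf
  have hflip : ∀ x : Bit, ((if x = 0 then (1 : ℝ) else 0) + if x + 1 = 0 then (1 : ℝ) else 0) = 1 := by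
    intro x
    have : (x = 0 ∧ ¬ x + 1 = 0) ∨ (¬ x = 0 ∧ x + 1 = 0) := by
      revert x
      decide
    rcases this with ⟨h1, h2⟩ | ⟨h1, h2⟩ <;> simp [h1, h2]
  have h := uniformExp_comp_equiv (Equiv.addRight (Pi.single f (1 : Bit)))
    (fun a : Fin F → Bit => if a ⬝ᵥ v = 0 then (1 : ℝ) else 0)
  have h2 := uniformExp_add (fun a : Fin F → Bit => if a ⬝ᵥ v = 0 then (1 : ℝ) else 0)
    (fun a : Fin F → Bit => if (Equiv.addRight (Pi.single f (1 : Bit)) a) ⬝ᵥ v = 0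
      then (1 : ℝ) else 0)
  rw [h] at h2
  simp only [Equiv.coe_addRight, add_dotProduct, single_dotProduct, one_mul, hf1, hflip,
    uniformExp_const] at h2
  linarith

theorem uniformProb_forall_dotProduct_eq_zero {v : Fin F → Bit} (hv : v ≠ 0) (i : Fin N)
    {t : ℕ} (ht : t ≤ r) :
    uniformProb {A : Coefficients N F r | ∀ s : Fin r, (s : ℕ) < t → A i s ⬝ᵥ v = 0} ≤
      (1 / 2) ^ t := by
  classical
  let φ : Fin r → (Fin F → Bit) → ℝ := fun s a =>
    if (s : ℕ) < t → a ⬝ᵥ v = 0 then 1 else 0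
  have h1 : uniformProb {A : Coefficients N F r | ∀ s : Fin r, (s : ℕ) < t → A i s ⬝ᵥ v = 0} ≤
      uniformExp (fun A : Coefficients N F r => ∏ s, φ s (A i s)) := by
    refine uniformProb_le_uniformExp (fun A => Finset.prod_nonneg fun s _ => ?_) fun A hA => ?_
    · simp only [φ]
      split_ifs <;> norm_num
    · rw [Finset.prod_eq_one fun s _ => ?_]
      exact if_pos (hA s)
  refine h1.trans_eq ?_
  rw [uniformExp_eval i fun a : Fin r → Fin F → Bit => ∏ s, φ s (a s),
    uniformExp_pi (α := fun _ : Fin r => Fin F → Bit) φ]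
  have hφ : ∀ s : Fin r, uniformExp (φ s) = if (s : ℕ) < t then 1 / 2 else 1 := fun s => by
    by_cases hs : (s : ℕ) < t
    · simp only [φ, hs, forall_const, if_true]
      exact uniformExp_dotProduct_eq_zero hv
    · simp only [φ, hs, false_imp_iff, if_true, if_false, uniformExp_const]
  simp only [hφ]
  rw [Finset.prod_ite, Finset.prod_const_one, mul_one, Finset.prod_const]
  congr 1
  rw [Fin.card_filter_val_lt, min_eq_right ht]

end RandomCombinations

/-! ### Lists of bits -/

section Lists

theorem padXor_getD {ι : Type} (s : Finset ι) (l : ι → List Bit) (t : ℕ) :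
    (padXor s l).getD t 0 = ∑ v ∈ s, (l v).getD t 0 := by
  unfold padXor
  by_cases ht : t < s.sup fun v => (l v).length
  · rw [List.getD_eq_getElem _ _ (by simpa using ht), List.getElem_ofFn]
  · rw [List.getD_eq_default _ _ (by simpa using ht)]
    refine (Finset.sum_eq_zero fun v hv => List.getD_eq_default _ _ ?_).symm
    exact (Finset.le_sup (f := fun v => (l v).length) hv).trans (not_lt.1 ht)

theorem length_padXor {ι : Type} (s : Finset ι) (l : ι → List Bit) :
    (padXor s l).length = s.sup fun v => (l v).length := by
  simp [padXor]

theorem eq_of_getD_eq {l l' : List Bit} (hlen : l.length = l'.length)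
    (h : ∀ t, l.getD t 0 = l'.getD t 0) : l = l' := by
  refine List.ext_getElem hlen fun t h1 h2 => ?_
  have ht := h t
  rwa [List.getD_eq_getElem _ _ h1, List.getD_eq_getElem _ _ h2] at ht

/-- All summands but one cancel. The lengths of the remaining ones must be known to agree, because
zero-padding hides trailing zeros. -/
theorem eq_of_padXor_eq {ι : Type} [DecidableEq ι] {s : Finset ι} {l l' : ι → List Bit}
    (h : padXor s l = padXor s l') {v : ι} (hv : v ∈ s) (hlen : (l v).length = (l' v).length)
    (hother : ∀ u ∈ s, u ≠ v → l u = l' u) : l v = l' v := by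
  refine eq_of_getD_eq hlen fun t => ?_
  have ht := congrArg (fun x : List Bit => x.getD t 0) h
  simp only [padXor_getD] at ht
  rw [← Finset.add_sum_erase _ _ hv, ← Finset.add_sum_erase s (fun u => (l' u).getD t 0) hv,
    Finset.sum_congr rfl fun u hu => by
      rw [hother u (Finset.mem_of_mem_erase hu) (Finset.ne_of_mem_erase hu)]] at ht
  exact add_right_cancel ht

theorem length_padXor₂ (a b : List Bit) : (padXor₂ a b).length = max a.length b.length := by
  rw [padXor₂, length_padXor]
  apply le_antisymm
  · refine Finset.sup_le fun v _ => ?_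
    fin_cases v <;> simp
  · exact max_le (Finset.le_sup (f := fun v => (![a, b] v).length) (Finset.mem_univ 0))
      (Finset.le_sup (f := fun v => (![a, b] v).length) (Finset.mem_univ 1))

theorem padXor₂_right_cancel {a a' b : List Bit} (hlen : a.length = a'.length)
    (h : padXor₂ a b = padXor₂ a' b) : a = a' := by
  refine eq_of_padXor_eq (v := 0) h (Finset.mem_univ _) hlen fun u _ hu => ?_
  fin_cases u <;> simp_all

theorem padXor₂_left_cancel {a b b' : List Bit} (hlen : b.length = b'.length)
    (h : padXor₂ a b = padXor₂ a b') : b = b' := by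
  refine eq_of_padXor_eq (v := 1) h (Finset.mem_univ _) hlen fun u _ hu => ?_
  fin_cases u <;> simp_all

theorem eq_of_flatMap_eq {α : Type} {l : List α} {f g : α → List Bit}
    (hlen : ∀ x ∈ l, (f x).length = (g x).length) (h : l.flatMap f = l.flatMap g) :
    ∀ x ∈ l, f x = g x := by
  induction l with
  | nil => simp
  | cons a l ih =>
    rw [List.flatMap_cons, List.flatMap_cons] at h
    obtain ⟨h1, h2⟩ := List.append_inj h (hlen a (by simp))
    intro x hx
    rcases List.mem_cons.1 hx with rfl | hx
    · exact h1
    · exact ih (fun x hx => hlen x (by simp [hx])) h2 x hx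

theorem length_flatMap_congr {α : Type} {l : List α} {f g : α → List Bit}
    (hlen : ∀ x ∈ l, (f x).length = (g x).length) :
    (l.flatMap f).length = (l.flatMap g).length := by
  rw [List.length_flatMap, List.length_flatMap, List.map_congr_left hlen]

theorem eq_of_fit_eq {n : ℕ} {l l' : List Bit} (hlen : l.length = l'.length) (hn : l.length ≤ n)
    (h : fit n l = fit n l') : l = l' := by
  refine eq_of_getD_eq hlen fun t => ?_
  by_cases ht : t < n
  · exact congrFun h ⟨t, ht⟩
  · rw [List.getD_eq_default _ _ (by omega), List.getD_eq_default _ _ (by omega)]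

end Lists

/-! ### Decoding -/

section Decoding

variable {N K F q : ℕ} {S : Placement N K F q} {W W' : Database N F} {d : Demand N K}

theorem length_cachedBits_eq (P : Fin N → {s : Finset (Fin F) // s.card = q})
    (W : Database N F) : (cachedBits P W).length = N * q := by
  have : ∀ i, ((List.finRange F).filter fun f => f ∈ (P i).1).length = q := fun i => by
    rw [← List.toFinset_card_of_nodup ((List.nodup_finRange F).filter _)]
    refine Eq.trans ?_ (P i).2
    congr 1
    ext f
    simp
  simp [cachedBits, List.length_flatMap, this]

theorem eq_of_cachedBits_eq {P : Fin N → {s : Finset (Fin F) // s.card = q}}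
    (h : cachedBits P W = cachedBits P W') (i : Fin N) (f : Fin F) (hf : f ∈ (P i).1) :
    W i f = W' i f := by
  have h1 := eq_of_flatMap_eq (fun i _ => by simp) h i (List.mem_finRange i)
  exact List.map_inj_left.1 h1 f (by simpa using hf)

theorem length_subfile (W' : Database N F) (i : Fin N) (V : Finset (Fin K)) :
    (subfile S W i V).length = (subfile S W' i V).length := by
  simp [subfile]

theorem subfile_eq_iff {i : Fin N} {V : Finset (Fin K)} :
    subfile S W i V = subfile S W' i V ↔
      ∀ f, (Finset.univ.filter fun k : Fin K => f ∈ (S k i).1) = V → W i f = W' i f := by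
  simp [subfile, List.map_inj_left]

theorem subfile_eq_of_mem {k : Fin K} (hc : ∀ i, ∀ f ∈ (S k i).1, W i f = W' i f) (i : Fin N)
    {V : Finset (Fin K)} (hk : k ∈ V) : subfile S W i V = subfile S W' i V := by
  refine subfile_eq_iff.2 fun f hf => hc i f ?_
  rw [← hf] at hk
  simpa using hk

theorem chain_cons_cons (i : Fin N) (a b : Fin K) (g : List (Fin K)) :
    chain S W i (a :: b :: g) =
      padXor₂ (subfile S W i {a}) (subfile S W i {b}) ++ chain S W i (b :: g) := by
  simp [chain]

theorem length_padXor₂_subfile (W' : Database N F) (i j : Fin N) (U V : Finset (Fin K)) :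
    (padXor₂ (subfile S W i U) (subfile S W j V)).length =
      (padXor₂ (subfile S W' i U) (subfile S W' j V)).length := by
  rw [length_padXor₂, length_padXor₂, length_subfile W' i, length_subfile W' j]

theorem length_chain_congr (W' : Database N F) (i : Fin N) (g : List (Fin K)) :
    (chain S W i g).length = (chain S W' i g).length := by
  induction g with
  | nil => rfl
  | cons a g ih =>
    cases g with
    | nil => rfl
    | cons b g =>
      rw [chain_cons_cons, chain_cons_cons, List.length_append, List.length_append, ih,
        length_padXor₂_subfile W']

/-- One known subfile unlocks the chain in both directions: each exclusive or of neighbours turns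
the known one into the other. -/
theorem subfile_eq_of_chain_eq {i : Fin N} {g : List (Fin K)}
    (h : chain S W i g = chain S W' i g) {u : Fin K} (hu : u ∈ g)
    (hsub : subfile S W i {u} = subfile S W' i {u}) :
    ∀ v ∈ g, subfile S W i {v} = subfile S W' i {v} := by
  induction g generalizing u with
  | nil => simp
  | cons a g ih =>
    cases g with
    | nil => simp_all
    | cons b g =>
      rw [chain_cons_cons, chain_cons_cons] at h
      obtain ⟨h1, h2⟩ := List.append_inj h (length_padXor₂_subfile W' _ _ _ _)
      rcases List.mem_cons.1 hu with rfl | hu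
      · rw [hsub] at h1
        have hb := padXor₂_left_cancel (length_subfile W' _ _) h1
        intro v hv
        rcases List.mem_cons.1 hv with rfl | hv
        · exact hsub
        · exact ih h2 (by simp) hb v hv
      -- The known user lies in the tail, so the tail is recovered first and then the head from its
      -- successor.
      · have hall := ih h2 hu hsub
        rw [hall b (by simp)] at h1
        intro v hv
        rcases List.mem_cons.1 hv with rfl | hv
        · exact padXor₂_right_cancel (length_subfile W' _ _) h1
        · exact hall v hv

theorem mem_group {i : Fin N} {k : Fin K} : k ∈ group d i ↔ d k = i := by
  simp [group]

theorem mem_requested {i : Fin N} : i ∈ requested d ↔ ∃ k, d k = i := by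
  simp [requested]

theorem exists_getLast?_group {i : Fin N} (hi : i ∈ requested d) :
    ∃ a, (group d i).getLast? = some a ∧ a ∈ group d i := by
  obtain ⟨k, hk⟩ := mem_requested.1 hi
  have hne : group d i ≠ [] := List.ne_nil_of_mem (mem_group.2 hk)
  exact ⟨_, List.getLast?_eq_getLast_of_ne_nil hne, List.getLast_mem hne⟩

theorem link_eq {i j : Fin N} {a b : Fin K} (ha : (group d i).getLast? = some a)
    (hb : (group d j).getLast? = some b) :
    link S W d i j = padXor₂ (subfile S W i {b}) (subfile S W j {a}) := by
  simp [link, ha, hb]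

theorem length_link_congr (W' : Database N F) (i j : Fin N) :
    (link S W d i j).length = (link S W' d i j).length := by
  unfold link
  split
  · exact length_padXor₂_subfile W' _ _ _ _
  · rfl

theorem length_part1_congr (W' : Database N F) :
    (part1 S W d).length = (part1 S W' d).length :=
  length_flatMap_congr fun _ _ => length_subfile W' _ _

theorem length_pair_congr (W' : Database N F) (i j : Fin N) :
    (chain S W i (group d j) ++ chain S W j (group d i) ++ link S W d i j).length =
      (chain S W' i (group d j) ++ chain S W' j (group d i) ++ link S W' d i j).length := by
  simp only [List.length_append, length_chain_congr W', length_link_congr W']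

theorem length_part2_congr (W' : Database N F) :
    (part2 S W d).length = (part2 S W' d).length := by
  unfold part2
  rw [List.length_append, List.length_append]
  congr 1
  · exact length_flatMap_congr fun _ _ => length_chain_congr W' _ _
  · exact length_flatMap_congr fun _ _ => length_flatMap_congr fun _ _ => length_pair_congr W' _ _

theorem length_padXor_subfile_congr (W' : Database N F) (U : Finset (Fin K)) :
    (padXor U fun u => subfile S W (d u) (U.erase u)).length =
      (padXor U fun u => subfile S W' (d u) (U.erase u)).length := by
  simp only [length_padXor, length_subfile W']

theorem length_part3_congr (W' : Database N F) :
    (part3 S W d).length = (part3 S W' d).length :=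
  length_flatMap_congr fun _ _ => length_padXor_subfile_congr W' _

theorem length_deliverCoded_congr (W' : Database N F) :
    (deliverCoded S W d).length = (deliverCoded S W' d).length := by
  simp only [deliverCoded, List.length_append, length_part1_congr W', length_part2_congr W',
    length_part3_congr W']

/-- The bits cached by a single user of the own group or of another group are recovered from the
second part of the coded delivery. -/
theorem subfile_singleton_eq_of_part2_eq {k : Fin K}
    (hc : ∀ i, ∀ f ∈ (S k i).1, W i f = W' i f) (h : part2 S W d = part2 S W' d) (u : Fin K) :
    subfile S W (d k) {u} = subfile S W' (d k) {u} := by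
  have hlen : ((requested d).flatMap fun i => chain S W i (group d i)).length =
      ((requested d).flatMap fun i => chain S W' i (group d i)).length :=
    length_flatMap_congr fun _ _ => length_chain_congr W' _ _
  obtain ⟨hown, hcross⟩ := List.append_inj h hlen
  have hreq : ∀ v, d v ∈ requested d := fun v => mem_requested.2 ⟨v, rfl⟩
  have hk : ∀ i, subfile S W i {k} = subfile S W' i {k} := fun i =>
    subfile_eq_of_mem hc i (Finset.mem_singleton_self k)
  have hpair : ∀ i ∈ requested d, ∀ j ∈ requested d, i < j →
      chain S W i (group d j) = chain S W' i (group d j) ∧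
      chain S W j (group d i) = chain S W' j (group d i) ∧
      link S W d i j = link S W' d i j := fun i hi j hj hij => by
    have h1 := eq_of_flatMap_eq (fun _ _ => length_flatMap_congr fun _ _ =>
      length_pair_congr W' _ _) hcross i hi
    have h2 := eq_of_flatMap_eq (fun _ _ => length_pair_congr W' _ _) h1 j (by simpa using ⟨hj, hij⟩)
    obtain ⟨h3, h4⟩ := List.append_inj h2 (by
      simp only [List.length_append, length_chain_congr W'])
    obtain ⟨h5, h6⟩ := List.append_inj h3 (length_chain_congr W' _ _)
    exact ⟨h5, h6, h4⟩
  rcases lt_trichotomy (d k) (d u) with hlt | heq | hgt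
  -- Let `a` and `b` be the last users of the groups of `k` and `u`. The chain of file `d u` leads
  -- from `k` to `a`, the link passes from `W_{d u,{a}}` to `W_{d k,{b}}`, and the chain of file `d
  -- k` leads from `b` to `u`.
  · obtain ⟨h1, h2, h3⟩ := hpair _ (hreq k) _ (hreq u) hlt
    obtain ⟨a, ha, ha'⟩ := exists_getLast?_group (hreq k)
    obtain ⟨b, hb, hb'⟩ := exists_getLast?_group (hreq u)
    have hja := subfile_eq_of_chain_eq h2 (mem_group.2 rfl) (hk (d u)) a ha'
    rw [link_eq ha hb, link_eq ha hb, hja] at h3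
    exact subfile_eq_of_chain_eq h1 hb' (padXor₂_right_cancel (length_subfile W' _ _) h3) u
      (mem_group.2 rfl)
  · have h1 := eq_of_flatMap_eq (fun _ _ => length_chain_congr W' _ _) hown _ (hreq k)
    exact subfile_eq_of_chain_eq h1 (mem_group.2 rfl) (hk _) u (mem_group.2 heq.symm)
  · obtain ⟨h1, h2, h3⟩ := hpair _ (hreq u) _ (hreq k) hgt
    obtain ⟨a, ha, ha'⟩ := exists_getLast?_group (hreq k)
    obtain ⟨b, hb, hb'⟩ := exists_getLast?_group (hreq u)
    have hja := subfile_eq_of_chain_eq h1 (mem_group.2 rfl) (hk (d u)) a ha'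
    rw [link_eq hb ha, link_eq hb ha, hja] at h3
    exact subfile_eq_of_chain_eq h2 hb' (padXor₂_left_cancel (length_subfile W' _ _) h3) u
      (mem_group.2 rfl)

/-- In the block for `U = V ∪ {k}`, every summand with `u ≠ k` consists of bits cached by `k`, so
only `W_{d k, V}` is unknown. -/
theorem subfile_eq_of_part3_eq {k : Fin K}
    (hc : ∀ i, ∀ f ∈ (S k i).1, W i f = W' i f) (h : part3 S W d = part3 S W' d)
    {V : Finset (Fin K)} (hV : 2 ≤ V.card) (hkV : k ∉ V) :
    subfile S W (d k) V = subfile S W' (d k) V := by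
  have hU : insert k V ∈ ((Finset.univ : Finset (Finset (Fin K))).filter
      fun U => 3 ≤ U.card).toList := by
    simp [Finset.card_insert_of_notMem hkV]
    omega
  have h1 := eq_of_flatMap_eq (fun _ _ => length_padXor_subfile_congr W' _) h _ hU
  have h2 := eq_of_padXor_eq h1 (Finset.mem_insert_self k V) (length_subfile W' _ _)
    fun u _ hne => subfile_eq_of_mem hc _ (Finset.mem_erase.2 ⟨hne.symm, by simp⟩)
  simpa [Finset.erase_insert hkV] using h2

theorem eq_of_deliverCoded_eq {k : Fin K} (hc : ∀ i, ∀ f ∈ (S k i).1, W i f = W' i f)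
    (h : deliverCoded S W d = deliverCoded S W' d) : W (d k) = W' (d k) := by
  obtain ⟨h12, h3⟩ := List.append_inj h (by
    simp only [List.length_append, length_part1_congr W', length_part2_congr W'])
  obtain ⟨h1, h2⟩ := List.append_inj h12 (length_part1_congr W')
  have hall : ∀ V : Finset (Fin K), subfile S W (d k) V = subfile S W' (d k) V := fun V => by
    by_cases hk : k ∈ V
    · exact subfile_eq_of_mem hc _ hk
    rcases Nat.lt_or_ge V.card 2 with hV | hV
    · interval_cases hcard : V.card
      · rw [Finset.card_eq_zero.1 hcard]
        exact eq_of_flatMap_eq (fun _ _ => length_subfile W' _ _) h1 _ (mem_requested.2 ⟨k, rfl⟩)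
      · obtain ⟨u, rfl⟩ := Finset.card_eq_one.1 hcard
        exact subfile_singleton_eq_of_part2_eq hc h2 u
    · exact subfile_eq_of_part3_eq hc h3 hV hk
  -- The bit `f` lies in the subfile indexed by the exact set of users caching it.
  ext1 f
  exact subfile_eq_iff.1 (hall _) f rfl

variable {r : ℕ} {A : Coefficients N F r}

theorem length_deliverRandom_congr (W' : Database N F) :
    (deliverRandom S A W d).length = (deliverRandom S A W' d).length :=
  length_flatMap_congr fun _ _ => by simp

/-- If the minimum is attained only through the cap `r`, then `t ≤ r` forces it to equal `t`, which
is enough anyway. -/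
theorem enough_numCombinations {i : Fin N} {t : ℕ} (ht : t ≤ r) (h : Enough S A d i t) :
    numCombinations S A d i ≤ t ∧ Enough S A d i (numCombinations S A d i) := by
  have hle : numCombinations S A d i ≤ t := Nat.sInf_le (Or.inr h)
  refine ⟨hle, ?_⟩
  have hmem : r ≤ numCombinations S A d i ∨ Enough S A d i (numCombinations S A d i) :=
    Nat.sInf_mem (s := {t | r ≤ t ∨ Enough S A d i t}) ⟨t, Or.inr h⟩
  rcases hmem with hr | he
  · rwa [show numCombinations S A d i = t by omega]
  · exact he

theorem eq_of_deliverRandom_eq {k : Fin K} (hc : ∀ i, ∀ f ∈ (S k i).1, W i f = W' i f)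
    (hE : Enough S A d (d k) (numCombinations S A d (d k)))
    (h : deliverRandom S A W d = deliverRandom S A W' d) : W (d k) = W' (d k) := by
  refine hE k rfl _ _ (hc (d k)) fun s hs => ?_
  have h1 := eq_of_flatMap_eq (fun _ _ => by simp) h _ (mem_requested.2 ⟨k, rfl⟩)
  refine List.map_inj_left.1 h1 s ?_
  rw [List.mem_take_iff_getElem]
  exact ⟨s, by simpa using hs, by simp⟩

theorem length_deliverGBD_congr (W' : Database N F) :
    (deliverGBD S A W d).length = (deliverGBD S A W' d).length := by
  unfold deliverGBD
  rw [length_deliverCoded_congr W', length_deliverRandom_congr W']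
  split_ifs
  · exact length_deliverCoded_congr W'
  · exact length_deliverRandom_congr W'

theorem length_deliverGBD :
    (deliverGBD S A W d).length =
      min (deliverCoded S W d).length (deliverRandom S A W d).length := by
  unfold deliverGBD
  split_ifs <;> omega

/-- The lengths do not depend on the file contents, so both databases lead to the same choice of
procedure. -/
theorem eq_of_deliverGBD_eq {k : Fin K} (hc : ∀ i, ∀ f ∈ (S k i).1, W i f = W' i f)
    (hE : Enough S A d (d k) (numCombinations S A d (d k)))
    (h : deliverGBD S A W d = deliverGBD S A W' d) : W (d k) = W' (d k) := by
  unfold deliverGBD at h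
  rw [length_deliverCoded_congr W', length_deliverRandom_congr W'] at h
  split_ifs at h
  · exact eq_of_deliverCoded_eq hc h
  · exact eq_of_deliverRandom_eq hc hE h

/-- If the delivered bits fit into the message and the numbers of linear combinations are
sufficient, then no user fails. -/
theorem errorEvent_gbdCode_eq_empty {m : ℕ} (hm : N * q ≤ m)
    (hE : ∀ i, Enough S A d i (numCombinations S A d i))
    (hr : ∀ W, (deliverGBD S A W d).length ≤ r) :
    (gbdCode S A : Code N K F m r).errorEvent d = ∅ := by
  refine Set.eq_empty_of_forall_notMem fun W hW => ?_
  obtain ⟨k, hk⟩ := hW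
  apply hk
  have hex : ∃ W' : Database N F, fit m (cachedBits (S k) W') = fit m (cachedBits (S k) W) ∧
      fit r (deliverGBD S A W' d) = fit r (deliverGBD S A W d) := ⟨W, rfl, rfl⟩
  simp only [gbdCode]
  rw [dif_pos hex]
  obtain ⟨h1, h2⟩ := hex.choose_spec
  -- The database picked by the decoder may differ from `W`, but it is consistent with all that user
  -- `k` sees, and this determines the requested file.
  refine eq_of_deliverGBD_eq (eq_of_cachedBits_eq (eq_of_fit_eq ?_ ?_ h1)) (hE _)
    (eq_of_fit_eq (length_deliverGBD_congr _) (hr _) h2)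
  · rw [length_cachedBits_eq, length_cachedBits_eq]
  · rwa [length_cachedBits_eq]

end Decoding

/-! ### Length of the coded delivery -/

section CodedLength

theorem length_flatMap_le {α : Type} [DecidableEq α] {l : List α} (hl : l.Nodup)
    {f : α → List Bit} {g : α → ℝ} (h : ∀ x ∈ l, ((f x).length : ℝ) ≤ g x) :
    ((l.flatMap f).length : ℝ) ≤ ∑ x ∈ l.toFinset, g x := by
  have : ((l.flatMap f).length : ℝ) = ∑ x ∈ l.toFinset, ((f x).length : ℝ) := by
    rw [List.length_flatMap, ← List.sum_toFinset _ hl, Nat.cast_sum]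
  rw [this]
  exact Finset.sum_le_sum fun x hx => h x (List.mem_toFinset.1 hx)

theorem sum_sum_eq_two_mul_sum_lt {N : ℕ} (R : Finset (Fin N)) (g : Fin N → Fin N → ℝ)
    (hg : ∀ i j, g i j = g j i) :
    ∑ i ∈ R, ∑ j ∈ R, g i j = 2 * ∑ i ∈ R, ∑ j ∈ R with i < j, g i j + ∑ i ∈ R, g i i := by
  have hsplit : ∀ i ∈ R, ∑ j ∈ R, g i j =
      ∑ j ∈ R with i < j, g i j + ∑ j ∈ R with j < i, g i j + g i i := fun i hi => by
    simp only [Finset.sum_filter]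
    rw [← Finset.sum_add_distrib]
    have : g i i = ∑ j ∈ R, if j = i then g i j else 0 := by
      rw [Finset.sum_ite_eq']
      simp [hi]
    rw [this, ← Finset.sum_add_distrib]
    refine Finset.sum_congr rfl fun j _ => ?_
    rcases lt_trichotomy i j with h | rfl | h
    · simp [h, h.ne', h.not_gt]
    · simp
    · simp [h, h.ne, h.not_gt]
  have hswap : ∑ i ∈ R, ∑ j ∈ R with j < i, g i j = ∑ i ∈ R, ∑ j ∈ R with i < j, g i j := by
    rw [Finset.sum_comm' (t' := R) (s' := fun j => R.filter fun i => j < i)]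
    · exact Finset.sum_congr rfl fun j _ => Finset.sum_congr rfl fun i _ => hg i j
    · simp only [Finset.mem_filter]
      tauto
  rw [Finset.sum_congr rfl hsplit, Finset.sum_add_distrib, Finset.sum_add_distrib, hswap]
  ring

/-- Bound for the length of the coded delivery when `L` files are requested and a subfile
`W_{i,V}` has at most `b |V|` bits. -/
def codedBound (K : ℕ) (L : ℝ) (b : ℕ → ℝ) : ℝ :=
  L * b 0 + (L * K - L * (L + 1) / 2) * b 1 +
    ∑ U : Finset (Fin K) with 3 ≤ U.card, b (U.card - 1)

variable {N K F q : ℕ} {S : Placement N K F q} {W : Database N F} {d : Demand N K} {b : ℕ → ℝ}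

theorem length_padXor₂_subfile_le
    (hb : ∀ i V, ((subfile S W i V).length : ℝ) ≤ b V.card) (i j : Fin N) (u v : Fin K) :
    ((padXor₂ (subfile S W i {u}) (subfile S W j {v})).length : ℝ) ≤ b 1 := by
  rw [length_padXor₂, Nat.cast_max]
  exact max_le (by simpa using hb i {u}) (by simpa using hb j {v})

theorem length_chain_le (hb : ∀ i V, ((subfile S W i V).length : ℝ) ≤ b V.card) (i : Fin N)
    {g : List (Fin K)} (hg : g ≠ []) :
    ((chain S W i g).length : ℝ) ≤ (g.length - 1) * b 1 := by
  induction g with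
  | nil => exact absurd rfl hg
  | cons a g ih =>
    cases g with
    | nil => simp [chain]
    | cons c g =>
      rw [chain_cons_cons, List.length_append]
      have h1 := length_padXor₂_subfile_le hb i i a c
      have h2 := ih (by simp)
      push_cast [List.length_cons] at h2 ⊢
      linarith

theorem nodup_requested : (requested d).Nodup := (List.nodup_finRange N).filter _

theorem group_ne_nil {i : Fin N} (hi : i ∈ requested d) : group d i ≠ [] := by
  obtain ⟨k, hk⟩ := mem_requested.1 hi
  exact List.ne_nil_of_mem (mem_group.2 hk)

theorem sum_length_group :
    ∑ i ∈ (requested d).toFinset, ((group d i).length : ℝ) = K := by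
  have h := Finset.card_eq_sum_card_fiberwise (f := d) (s := Finset.univ)
    (t := (requested d).toFinset) fun k _ => by
      simpa using mem_requested.2 ⟨k, rfl⟩
  rw [Finset.card_univ, Fintype.card_fin] at h
  conv_rhs => rw [h]
  rw [Nat.cast_sum]
  refine Finset.sum_congr rfl fun i _ => ?_
  rw [group, ← List.toFinset_card_of_nodup ((List.nodup_finRange K).filter _)]
  congr 2
  ext k
  simp

/-- With `L` requested files and group sizes `n i` adding up to `K`, part 2 has `∑ (n i - 1) = K -
L` blocks within groups and `(n j - 1) + (n i - 1) + 1` for each pair `i < j`; the total is `LK -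
L(L+1)/2`. Parts 1 and 3 have one block per requested file and per set `U`. -/
theorem length_deliverCoded_le (hb : ∀ i V, ((subfile S W i V).length : ℝ) ≤ b V.card)
    (hb0 : ∀ v, 0 ≤ b v) :
    ((deliverCoded S W d).length : ℝ) ≤ codedBound K (requested d).length b := by
  set R := (requested d).toFinset with hR
  have hcard : (R.card : ℝ) = (requested d).length := by
    rw [hR, List.toFinset_card_of_nodup nodup_requested]
  set n : Fin N → ℝ := fun i => (group d i).length with hn
  have h1 : ((part1 S W d).length : ℝ) ≤ ∑ i ∈ R, b 0 :=
    length_flatMap_le nodup_requested fun i _ => by simpa using hb i ∅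
  have h2 : (((requested d).flatMap fun i => chain S W i (group d i)).length : ℝ) ≤
      ∑ i ∈ R, (n i - 1) * b 1 :=
    length_flatMap_le nodup_requested fun i hi => length_chain_le hb i (group_ne_nil hi)
  have h3 : (((requested d).flatMap fun i => ((requested d).filter fun j => i < j).flatMap fun j =>
      chain S W i (group d j) ++ chain S W j (group d i) ++ link S W d i j).length : ℝ) ≤
      ∑ i ∈ R, ∑ j ∈ R with i < j, (n i + n j - 1) * b 1 := by
    refine length_flatMap_le nodup_requested fun i hi => ?_
    have hfilter : ((requested d).filter fun j => i < j).toFinset = R.filter fun j => i < j := by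
      ext j
      simp [hR]
    rw [← hfilter]
    refine length_flatMap_le (nodup_requested.filter _) fun j hj => ?_
    have hj' : j ∈ requested d := (List.mem_filter.1 hj).1
    obtain ⟨a, ha, -⟩ := exists_getLast?_group hi
    obtain ⟨c, hc, -⟩ := exists_getLast?_group hj'
    rw [List.length_append, List.length_append, link_eq ha hc]
    have e1 := length_chain_le hb i (group_ne_nil hj')
    have e2 := length_chain_le hb j (group_ne_nil hi)
    have e3 := length_padXor₂_subfile_le hb i j c a
    push_cast
    simp only [hn]
    linarith
  have h4 : ((part3 S W d).length : ℝ) ≤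
      ∑ U : Finset (Fin K) with 3 ≤ U.card, b (U.card - 1) := by
    have := length_flatMap_le (l := ((Finset.univ : Finset (Finset (Fin K))).filter
      fun U => 3 ≤ U.card).toList) (Finset.nodup_toList _)
      (f := fun U => padXor U fun u => subfile S W (d u) (U.erase u))
      (g := fun U => b (U.card - 1)) fun U _ => by
        rw [length_padXor]
        refine Finset.sup_induction (p := fun x : ℕ => (x : ℝ) ≤ b (U.card - 1)) ?_ ?_ ?_
        · simpa using hb0 _
        · intro x hx y hy
          rw [Nat.cast_max]
          exact max_le hx hy
        · intro u hu
          rw [← Finset.card_erase_of_mem hu]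
          exact hb _ _
    rwa [Finset.toList_toFinset] at this
  have hsum : ∑ i ∈ R, n i = K := sum_length_group
  have h2' : ∑ i ∈ R, (n i - 1) * b 1 = (K - R.card) * b 1 := by
    rw [← Finset.sum_mul, Finset.sum_sub_distrib, hsum]
    simp
  have h3' : ∑ i ∈ R, ∑ j ∈ R with i < j, (n i + n j - 1) * b 1 =
      (R.card * K - R.card ^ 2 / 2 - K + R.card / 2) * b 1 := by
    -- The sum over `i < j` is half of the full symmetric double sum without its diagonal.
    have h := sum_sum_eq_two_mul_sum_lt R (fun i j => n i + n j - 1) fun i j => by ring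
    simp only [Finset.sum_sub_distrib, Finset.sum_add_distrib, Finset.sum_const, hsum,
      nsmul_eq_mul, mul_one, ← Finset.mul_sum] at h
    simp only [← Finset.sum_mul, Finset.sum_sub_distrib, Finset.sum_add_distrib, Finset.sum_const,
      nsmul_eq_mul, mul_one]
    congr 1
    linarith
  rw [h2'] at h2
  rw [h3'] at h3
  simp only [Finset.sum_const, nsmul_eq_mul] at h1
  rw [hcard] at h1 h2 h3
  rw [deliverCoded, part2, List.length_append, List.length_append, List.length_append, codedBound]
  push_cast
  linarith

end CodedLength

/-! ### The limiting rate -/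

section Rate

theorem sum_card_ge_three {n : ℕ} (h : ℕ → ℝ) :
    ∑ U : Finset (Fin (n + 2)) with 3 ≤ U.card, h U.card =
      ∑ m ∈ Finset.range n, ((n + 2).choose (m + 3) : ℝ) * h (m + 3) := by
  rw [Finset.sum_filter, ← Finset.powerset_univ,
    Finset.sum_powerset_apply_card (fun m => if 3 ≤ m then h m else 0)]
  simp only [Finset.card_univ, Fintype.card_fin, nsmul_eq_mul]
  rw [Finset.sum_range_succ', Finset.sum_range_succ', Finset.sum_range_succ']
  simp

/-- The probability that a binomial variable with parameters `n + 2` and `p` is at least `3`. -/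
theorem sum_binomial_ge_three {p : ℝ} (n : ℕ) :
    ∑ m ∈ Finset.range n, ((n + 2).choose (m + 3) : ℝ) *
      (p ^ (m + 3) * (1 - p) ^ (n + 2 - (m + 3))) =
      1 - ((1 - p) ^ (n + 2) + (n + 2) * p * (1 - p) ^ (n + 1) +
        (n + 2) * (n + 1) / 2 * p ^ 2 * (1 - p) ^ n) := by
  have h := add_pow p (1 - p) (n + 2)
  rw [add_sub_cancel, one_pow, Finset.sum_range_succ', Finset.sum_range_succ',
    Finset.sum_range_succ'] at h
  have hc : (((n + 2).choose 2 : ℕ) : ℝ) = (n + 2) * (n + 1) / 2 := by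
    rw [Nat.cast_choose_two]
    push_cast
    ring
  simp only [zero_add, Nat.choose_zero_right, Nat.choose_one_right, hc, pow_zero,
    pow_one, Nat.cast_one, Nat.cast_add, Nat.cast_ofNat, Nat.add_sub_cancel,
    show n + 2 - 1 = n + 1 by omega, Nat.sub_zero, mul_one, one_mul, add_assoc, one_add_one_eq_two,
    two_add_one_eq_three] at h
  have hcomm : ∀ m, ((n + 2).choose (m + 3) : ℝ) * (p ^ (m + 3) * (1 - p) ^ (n + 2 - (m + 3))) =
    p ^ (m + 3) * (1 - p) ^ (n + 2 - (m + 3)) * ((n + 2).choose (m + 3) : ℝ) := fun m => by ring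
  simp only [hcomm]
  linarith

theorem binomial_three_terms_le_one {p : ℝ} (hp0 : 0 ≤ p) (hp1 : p ≤ 1) (n : ℕ) :
    (1 - p) ^ (n + 2) + (n + 2) * p * (1 - p) ^ (n + 1) +
      (n + 2) * (n + 1) / 2 * p ^ 2 * (1 - p) ^ n ≤ 1 := by
  have h := sum_binomial_ge_three (p := p) n
  have hq : 0 ≤ 1 - p := by linarith
  have h0 : 0 ≤ ∑ m ∈ Finset.range n, ((n + 2).choose (m + 3) : ℝ) *
      (p ^ (m + 3) * (1 - p) ^ (n + 2 - (m + 3))) :=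
    Finset.sum_nonneg fun m _ => by positivity
  linarith

/-- A block of part 3 has relative size `p^(|U|-1) (1-p)^(K-|U|+1)`, which is `(1-p)/p` times the
binomial weight `p^|U| (1-p)^(K-|U|)`. The sum over `U` is thus `(1-p)/p` times a binomial tail;
this is where `p ≠ 0` enters. -/
theorem codedBound_subfileProb {p : ℝ} (hp : p ≠ 0) (n : ℕ) (L : ℝ) :
    codedBound (n + 2) L (subfileProb (n + 2) p) =
      L * (1 - p) ^ (n + 2) + (L * (n + 2) - L * (L + 1) / 2) * (p * (1 - p) ^ (n + 1)) +
        (1 - p) / p * (1 - ((1 - p) ^ (n + 2) + (n + 2) * p * (1 - p) ^ (n + 1) +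
          (n + 2) * (n + 1) / 2 * p ^ 2 * (1 - p) ^ n)) := by
  rw [codedBound, ← sum_binomial_ge_three, ← sum_card_ge_three
    (fun m => p ^ m * (1 - p) ^ (n + 2 - m)), Finset.mul_sum]
  congr 1
  · simp [subfileProb]
  · refine Finset.sum_congr rfl fun U hU => ?_
    have h3 : 3 ≤ U.card := (Finset.mem_filter.1 hU).2
    have hle : U.card ≤ n + 2 := by simpa using Finset.card_le_univ U
    obtain ⟨m, hm⟩ := Nat.exists_eq_add_of_le' h3
    rw [hm] at hle ⊢
    rw [subfileProb, show n + 2 - (m + 3 - 1) = n + 2 - (m + 3) + 1 by omega,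
      show m + 3 - 1 = m + 2 by omega]
    field_simp
    ring

theorem codedBound_eq {p : ℝ} (hp : p ≠ 0) (n : ℕ) (L : ℝ) :
    codedBound (n + 2) L (subfileProb (n + 2) p) =
      (1 - p) * (1 / p - (((n + 2 : ℝ) - L - 2) * (1 + 1 / 2 * ((n + 2 : ℝ) - L - 1) * p) + 1 / p) *
        (1 - p) ^ n) := by
  rw [codedBound_subfileProb hp]
  field_simp
  ring

/-- The coefficient of `b 1` grows by `(L'-L)(K - (L+L'+1)/2)`, which is nonnegative as `L ≤ L' ≤ K
- 1`. Hence the worst demands request all `N` files. -/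
theorem codedBound_mono_left {K : ℕ} {b : ℕ → ℝ} (hb : ∀ v, 0 ≤ b v) {L L' : ℝ} (hL : L ≤ L')
    (hL' : L' + 1 ≤ K) : codedBound K L b ≤ codedBound K L' b := by
  have h1 : 0 ≤ (L' - L) * b 0 := mul_nonneg (by linarith) (hb 0)
  have h2 : 0 ≤ ((L' - L) * (K - (L' + L + 1) / 2)) * b 1 :=
    mul_nonneg (mul_nonneg (by linarith) (by linarith)) (hb 1)
  unfold codedBound
  nlinarith

theorem subfileProb_nonneg {K : ℕ} {p : ℝ} (hp0 : 0 ≤ p) (hp1 : p ≤ 1) (v : ℕ) :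
    0 ≤ subfileProb K p v :=
  mul_nonneg (pow_nonneg hp0 _) (pow_nonneg (by linarith) _)

/-- Any rate above the coded bound also exceeds `1 - p`, so the cap on the number of random
combinations is harmless. By monotonicity it suffices to take `L = 1`. -/
theorem one_sub_le_codedBound {p : ℝ} (hp0 : 0 < p) (hp1 : p ≤ 1) {n : ℕ} {L : ℝ} (hL : 1 ≤ L)
    (hLn : L + 1 ≤ n + 2) : 1 - p ≤ codedBound (n + 2) L (subfileProb (n + 2) p) := by
  have hq : 0 ≤ 1 - p := by linarith
  refine le_trans ?_ (codedBound_mono_left (subfileProb_nonneg hp0.le hp1) hL (by push_cast; exact hLn))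
  rw [codedBound_eq hp0.ne', mul_comm]
  refine le_mul_of_one_le_left hq ?_
  -- For `n = m + 1` the left side equals `1 - p` times the probability that a binomial variable
  -- with parameters `m + 2` and `p` is at most 2; for `n = 0` there is equality.
  have key : ((n + 2 : ℝ) - 1 - 2) * (1 + 1 / 2 * ((n + 2 : ℝ) - 1 - 1) * p) * (1 - p) ^ n * p +
      (1 - p) ^ n ≤ 1 - p := by
    cases n with
    | zero =>
      norm_num
    | succ m =>
      have h := mul_le_mul_of_nonneg_left (binomial_three_terms_le_one hp0.le hp1 m) hq
      push_cast
      refine le_trans (le_of_eq ?_) (h.trans_eq (mul_one _))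
      ring
  rw [le_sub_iff_add_le, add_comm, ← le_sub_iff_add_le]
  rw [← mul_le_mul_iff_left₀ hp0]
  have e : (1 / p - 1) * p = 1 - p := by field_simp
  rw [e]
  refine le_trans (le_of_eq ?_) key
  field_simp

/-- The sensitivity of `codedBound` to the sizes of the subfiles. -/
theorem codedBound_scale_add {K : ℕ} (L c e : ℝ) (b : ℕ → ℝ) :
    codedBound K L (fun v => c * (b v + e)) =
      c * (codedBound K L b + e * codedBound K L fun _ => 1) := by
  simp only [codedBound, ← Finset.mul_sum, Finset.sum_add_distrib, Finset.sum_const, nsmul_eq_mul]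
  ring

theorem gbdRate_eq_min {N n : ℕ} (hN : 1 ≤ N) {M : ℝ} (hM0 : 0 < M) (hMN : M ≤ N) :
    gbdRate N (n + 2) M =
      min (codedBound (n + 2) N (subfileProb (n + 2) (M / N))) (N * (1 - M / N)) := by
  have hN' : (0 : ℝ) < N := by exact_mod_cast hN
  have hq : 0 ≤ 1 - M / N := by
    rw [sub_nonneg, div_le_one hN']
    exact hMN
  rw [codedBound_eq (by positivity), mul_comm (N : ℝ), ← mul_min_of_nonneg _ _ hq]
  simp [gbdRate]

end Rate

/-! ### Error probability of the random code -/

section ErrorProbability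

variable {N K F q r m : ℕ}

/-- The random combinations of the bits of each file up to number `t` determine the file for every
user, whatever the demands are. -/
def Determined (S : Placement N K F q) (A : Coefficients N F r) (t : ℕ) : Prop :=
  ∀ i k, ∀ v : Fin F → Bit, v ≠ 0 → (∀ f ∈ (S k i).1, v f = 0) →
    ∃ s : Fin r, (s : ℕ) < t ∧ A i s ⬝ᵥ v ≠ 0

theorem Determined.enough {S : Placement N K F q} {A : Coefficients N F r} {t : ℕ}
    (h : Determined S A t) (d : Demand N K) (i : Fin N) : Enough S A d i t := by
  intro k _ w w' hw hs
  by_contra hne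
  obtain ⟨s, hst, hs0⟩ := h i k (w - w') (sub_ne_zero.2 hne) fun f hf => by simp [hw f hf]
  exact hs0 (by rw [dotProduct_sub, hs s hst, sub_self])

/-- Such a vector is determined by its `F - q` coordinates outside `s`. -/
theorem card_vanishing_le (s : {s : Finset (Fin F) // s.card = q}) :
    Fintype.card {v : Fin F → Bit // v ≠ 0 ∧ ∀ f ∈ s.1, v f = 0} ≤ 2 ^ (F - q) := by
  have hinj : Function.Injective fun (v : {v : Fin F → Bit // v ≠ 0 ∧ ∀ f ∈ s.1, v f = 0})
      (f : {f // f ∈ (s.1)ᶜ}) => v.1 f.1 := by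
    intro v w hvw
    ext1
    ext1 f
    by_cases hf : f ∈ s.1
    · rw [v.2.2 f hf, w.2.2 f hf]
    · exact congrFun hvw ⟨f, Finset.mem_compl.2 hf⟩
  refine (Fintype.card_le_of_injective _ hinj).trans_eq ?_
  rw [Fintype.card_fun, ZMod.card, Fintype.card_coe, Finset.card_compl, s.2, Fintype.card_fin]

/-- Union bound over files, users and the at most `2^(F-q)` nonzero vectors vanishing on a cache;
these exhaust `F - q` of the combinations and leave the factor `2^-e`. -/
theorem uniformProb_not_determined (S : Placement N K F q) {e : ℕ} (ht : F - q + e ≤ r) :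
    uniformProb {A : Coefficients N F r | ¬ Determined S A (F - q + e)} ≤ N * K * (1 / 2) ^ e := by
  have hsub : {A : Coefficients N F r | ¬ Determined S A (F - q + e)} ⊆
      ⋃ i : Fin N, ⋃ k : Fin K, ⋃ v : {v : Fin F → Bit // v ≠ 0 ∧ ∀ f ∈ (S k i).1, v f = 0},
        {A | ∀ s : Fin r, (s : ℕ) < F - q + e → A i s ⬝ᵥ v.1 = 0} := by
    intro A hA
    simp only [Determined, Set.mem_ofPred_eq, not_forall, not_exists, not_and, not_not] at hA
    obtain ⟨i, k, v, hv, hv', h⟩ := hA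
    simp only [Set.mem_iUnion]
    exact ⟨i, k, ⟨v, hv, hv'⟩, h⟩
  have hle : ∀ (i : Fin N) (k : Fin K), uniformProb
      (⋃ v : {v : Fin F → Bit // v ≠ 0 ∧ ∀ f ∈ (S k i).1, v f = 0},
        {A : Coefficients N F r | ∀ s : Fin r, (s : ℕ) < F - q + e → A i s ⬝ᵥ v.1 = 0}) ≤
      (1 / 2) ^ e := fun i k => by
    refine (uniformProb_iUnion_le _).trans ((Finset.sum_le_sum fun v _ =>
      uniformProb_forall_dotProduct_eq_zero v.2.1 i ht).trans ?_)
    rw [Finset.sum_const, Finset.card_univ, nsmul_eq_mul]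
    calc _ ≤ ((2 ^ (F - q) : ℕ) : ℝ) * (1 / 2) ^ (F - q + e) :=
          mul_le_mul_of_nonneg_right (by exact_mod_cast card_vanishing_le _) (by positivity)
      _ = (1 / 2) ^ e := by
          rw [pow_add, ← mul_assoc]
          push_cast
          rw [← mul_pow]
          norm_num
  refine (uniformProb_mono hsub).trans ((uniformProb_iUnion_le _).trans ?_)
  refine (Finset.sum_le_sum fun i _ => (uniformProb_iUnion_le _).trans
    (Finset.sum_le_sum fun k _ => hle i k)).trans_eq ?_
  simp [mul_assoc]

theorem uniformProb_prod_le {Ω Ω' : Type} [Fintype Ω] [Fintype Ω'] [Nonempty Ω] [Nonempty Ω']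
    (E : Set (Ω × Ω')) {c : ℝ} (h : ∀ ω, uniformProb {ω' | (ω, ω') ∈ E} ≤ c) :
    uniformProb E ≤ c := by
  have hc : (0 : ℝ) < Fintype.card Ω := by exact_mod_cast Fintype.card_pos
  have hc' : (0 : ℝ) < Fintype.card Ω' := by exact_mod_cast Fintype.card_pos
  simp only [uniformProb_eq_uniformExp, uniformExp, div_le_iff₀ hc'] at h
  rw [uniformProb_eq_uniformExp, uniformExp, Fintype.sum_prod_type, Fintype.card_prod,
    div_le_iff₀ (by exact_mod_cast Nat.mul_pos Fintype.card_pos Fintype.card_pos)]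
  refine (Finset.sum_le_sum fun ω _ => h ω).trans_eq ?_
  simp
  ring

/-- All subfiles have at most their expected size up to a deviation of `ε F` bits. -/
def Typical (S : Placement N K F q) (ε : ℝ) : Prop :=
  ∀ i V, ((subfile S 0 i V).length : ℝ) ≤ F * subfileProb K ((q : ℝ) / F) V.card + ε * F

theorem uniformProb_not_typical (hq : q ≤ F) (hF : 0 < F) {ε : ℝ} (hε : 0 < ε) :
    uniformProb {S : Placement N K F q | ¬ Typical S ε} ≤ N * 2 ^ K * (1 / (ε ^ 2 * F)) := by
  have hsub : {S : Placement N K F q | ¬ Typical S ε} ⊆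
      ⋃ i : Fin N, ⋃ V : Finset (Fin K), {S : Placement N K F q |
        F * subfileProb K ((q : ℝ) / F) V.card + ε * F < (subfile S 0 i V).length} := by
    intro S hS
    simp only [Typical, Set.mem_ofPred_eq, not_forall, not_le] at hS
    obtain ⟨i, V, h⟩ := hS
    simp only [Set.mem_iUnion]
    exact ⟨i, V, h⟩
  refine (uniformProb_mono hsub).trans ((uniformProb_iUnion_le _).trans ?_)
  refine (Finset.sum_le_sum fun i _ => (uniformProb_iUnion_le _).trans
    (Finset.sum_le_sum fun V _ => uniformProb_length_subfile_gt hq 0 i V hε hF)).trans_eq ?_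
  simp [mul_assoc]

theorem errorProb_le_one (c : Code N K F m r) : c.errorProb ≤ 1 :=
  Real.iSup_le (fun _ => uniformProb_le_one _) zero_le_one

theorem length_deliverRandom_le {S : Placement N K F q} {A : Coefficients N F r} {t : ℕ}
    (ht : t ≤ r) (h : Determined S A t) (W : Database N F) (d : Demand N K) :
    (deliverRandom S A W d).length ≤ N * t := by
  have h1 : ((deliverRandom S A W d).length : ℝ) ≤ ∑ i ∈ (requested d).toFinset, (t : ℝ) :=
    length_flatMap_le nodup_requested fun i _ => by
      have := (enough_numCombinations ht (h.enough d i)).1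
      rw [List.length_map, List.length_take]
      exact_mod_cast (min_le_left _ _).trans this
  rw [Finset.sum_const, nsmul_eq_mul] at h1
  have h2 : (requested d).toFinset.card ≤ N := by
    simpa using Finset.card_le_univ (requested d).toFinset
  have h3 : (deliverRandom S A W d).length ≤ (requested d).toFinset.card * t := by exact_mod_cast h1
  exact h3.trans (Nat.mul_le_mul_right t h2)

theorem length_deliverCoded_le_of_typical (hNK : N < K) {S : Placement N K F q} {ε : ℝ}
    (hε : 0 ≤ ε) (h : Typical S ε) (hq : q ≤ F) (W : Database N F) (d : Demand N K) :
    ((deliverCoded S W d).length : ℝ) ≤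
      F * (codedBound K N (subfileProb K ((q : ℝ) / F)) + ε * codedBound K N fun _ => 1) := by
  have hp0 : 0 ≤ (q : ℝ) / F := by positivity
  have hp1 : (q : ℝ) / F ≤ 1 := div_le_one_of_le₀ (by exact_mod_cast hq) (Nat.cast_nonneg _)
  have hb0 : ∀ v, 0 ≤ (F : ℝ) * (subfileProb K ((q : ℝ) / F) v + ε) := fun v =>
    mul_nonneg (Nat.cast_nonneg _) (add_nonneg (subfileProb_nonneg hp0 hp1 v) hε)
  have h1 := length_deliverCoded_le (S := S) (W := W) (d := d)
    (b := fun v => F * (subfileProb K ((q : ℝ) / F) v + ε)) (fun i V => by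
      -- `Typical` is stated for the zero database, since sizes do not depend on contents.
      rw [length_subfile 0]
      exact (h i V).trans_eq (by ring)) hb0
  refine h1.trans ?_
  rw [← codedBound_scale_add]
  refine codedBound_mono_left hb0 ?_ (by exact_mod_cast hNK)
  have h2 : (requested d).length ≤ N := by
    simpa [requested] using List.length_filter_le (fun i => decide (∃ k, d k = i)) (List.finRange N)
  exact_mod_cast h2

theorem errorProb_gbdCode_eq_zero (hm : N * q ≤ m) {S : Placement N K F q}
    {A : Coefficients N F r} {t : ℕ} (ht : t ≤ r) (h : Determined S A t)
    (hr : ∀ W d, (deliverCoded S W d).length ≤ r ∨ (deliverRandom S A W d).length ≤ r) :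
    (gbdCode S A : Code N K F m r).errorProb = 0 := by
  have : ∀ d, (gbdCode S A : Code N K F m r).errorEvent d = ∅ := fun d =>
    errorEvent_gbdCode_eq_empty hm (fun i => (enough_numCombinations ht (h.enough d i)).2) fun W => by
      rw [length_deliverGBD]
      exact min_le_iff.2 (hr W d)
  simp [Code.errorProb, this, uniformProb_empty]

/-- Outside two bad events, an atypical placement and insufficient combinations, the error
probability is exactly 0; on them it is at most 1. The condition `ht` is needed under either
alternative of `hr`, because a capped random delivery might be selected merely for being short. -/
theorem uniformExp_errorProb_gbdCode_le (hq : q ≤ F) (hF : 0 < F) (hm : N * q ≤ m) (hNK : N < K)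
    {ε : ℝ} (hε : 0 < ε) {e : ℕ} (ht : F - q + e ≤ r)
    (hr : F * (codedBound K N (subfileProb K ((q : ℝ) / F)) + ε * codedBound K N fun _ => 1) < r + 1 ∨
      N * (F - q + e) ≤ r) :
    uniformExp (fun ω : Placement N K F q × Coefficients N F r =>
      (gbdCode ω.1 ω.2 : Code N K F m r).errorProb) ≤
      N * 2 ^ K * (1 / (ε ^ 2 * F)) + N * K * (1 / 2) ^ e := by
  have : Nonempty (Placement N K F q) := nonempty_placement hq
  let E₁ : Set (Placement N K F q × Coefficients N F r) := {ω | ω.1 ∈ {S | ¬ Typical S ε}}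
  let E₂ : Set (Placement N K F q × Coefficients N F r) := {ω | ¬ Determined ω.1 ω.2 (F - q + e)}
  have h1 : uniformProb E₁ ≤ N * 2 ^ K * (1 / (ε ^ 2 * F)) :=
    (uniformProb_preimage_fst _).trans_le (uniformProb_not_typical hq hF hε)
  have h2 : uniformProb E₂ ≤ N * K * (1 / 2) ^ e :=
    uniformProb_prod_le _ fun S => uniformProb_not_determined S ht
  refine le_trans ?_ ((uniformProb_union_le E₁ E₂).trans (add_le_add h1 h2))
  rw [uniformProb_eq_uniformExp]
  refine uniformExp_mono fun ω => ?_
  by_cases hω : ω ∈ E₁ ∪ E₂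
  · rw [Set.indicator_of_mem hω]
    exact errorProb_le_one _
  · rw [Set.indicator_of_notMem hω]
    simp only [E₁, E₂, Set.mem_union, Set.mem_ofPred_eq, not_or, not_not] at hω
    refine (errorProb_gbdCode_eq_zero hm ht hω.2 fun W d => ?_).le
    refine hr.imp (fun h => ?_) fun h => (length_deliverRandom_le ht hω.2 W d).trans h
    have := (length_deliverCoded_le_of_typical hNK hε.le hω.1 hq W d).trans_lt h
    -- The length is an integer, so being below `r + 1` suffices; this absorbs the rounding in `r =
    -- ⌊FR⌋`.
    exact Nat.lt_succ_iff.1 (by exact_mod_cast this)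

end ErrorProbability

/-! ### Asymptotics -/

section Asymptotics

theorem continuous_codedBound_subfileProb (K : ℕ) (L : ℝ) :
    Continuous fun p => codedBound K L (subfileProb K p) := by
  unfold codedBound subfileProb
  fun_prop

theorem tendsto_floor_mul_div_div (N : ℕ) {M : ℝ} (hM : 0 ≤ M) :
    Tendsto (fun F : ℕ => (⌊M * F / N⌋₊ : ℝ) / F) atTop (𝓝 (M / N)) := by
  have h := (tendsto_nat_floor_mul_div_atTop (R := ℝ) (a := M / N) (by positivity)).comp
    tendsto_natCast_atTop_atTop
  refine h.congr fun F => ?_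
  simp only [Function.comp]
  rw [div_mul_eq_mul_div]

theorem floor_le_file_length {N F : ℕ} (hN : 1 ≤ N) {M : ℝ} (hMN : M ≤ N) :
    ⌊M * F / N⌋₊ ≤ F := by
  have hN' : (0 : ℝ) < N := by exact_mod_cast hN
  refine Nat.floor_le_of_le ?_
  rw [div_le_iff₀ hN', mul_comm]
  exact mul_le_mul_of_nonneg_left hMN (Nat.cast_nonneg _)

theorem mul_floor_le_cache_size {N F : ℕ} (hN : 1 ≤ N) {M : ℝ} (hM0 : 0 ≤ M) :
    N * ⌊M * F / N⌋₊ ≤ ⌊(F : ℝ) * M⌋₊ := by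
  have hN' : (0 : ℝ) < N := by exact_mod_cast hN
  refine Nat.le_floor ?_
  push_cast
  have h := Nat.floor_le (a := M * F / N) (by positivity)
  rw [le_div_iff₀ hN'] at h
  linarith

/-- The random code succeeds with high probability at every rate above the limits of the rates
which the coded delivery (or the random delivery) needs. -/
theorem tendsto_gbdErrorProb {N K : ℕ} (hN : 1 ≤ N) (hNK : N < K) {M : ℝ} (hM0 : 0 < M)
    (hMN : M ≤ N) {R : ℝ} (hR : 1 - M / N < R)
    (hR' : codedBound K N (subfileProb K (M / N)) < R ∨ N * (1 - M / N) < R) :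
    Tendsto (fun F : ℕ => gbdErrorProb N K F M R) atTop (𝓝 0) := by
  have hN' : (0 : ℝ) < N := by exact_mod_cast hN
  have hp1 : M / N ≤ 1 := (div_le_one hN').2 hMN
  have hR0 : 0 < R := by linarith
  have hlim := tendsto_floor_mul_div_div N hM0.le
  -- The same slack `ε` serves as the allowed deviation of the subfile sizes and, through `e =
  -- ⌊εF⌋`, as the surplus of random combinations.
  obtain ⟨ε, hε, hε1, hε2⟩ : ∃ ε : ℝ, 0 < ε ∧ 1 - M / N + ε < R ∧
      (codedBound K N (subfileProb K (M / N)) + ε * codedBound K N (fun _ => 1) < R ∨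
        N * (1 - M / N + ε) < R) := by
    have ht1 : Tendsto (fun ε : ℝ => 1 - M / N + ε) (𝓝[>] 0) (𝓝 (1 - M / N + 0)) :=
      ((by fun_prop : Continuous fun ε : ℝ => 1 - M / N + ε).tendsto 0).mono_left
        nhdsWithin_le_nhds
    have ht2 : Tendsto (fun ε : ℝ => codedBound K N (subfileProb K (M / N)) +
        ε * codedBound K N (fun _ => 1)) (𝓝[>] 0)
        (𝓝 (codedBound K N (subfileProb K (M / N)) + 0 * codedBound K N (fun _ => 1))) :=
      ((by fun_prop : Continuous fun ε : ℝ => codedBound K N (subfileProb K (M / N)) +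
        ε * codedBound K N (fun _ => 1)).tendsto 0).mono_left nhdsWithin_le_nhds
    have ht3 := ht1.const_mul (N : ℝ)
    rw [add_zero] at ht1 ht3
    rw [zero_mul, add_zero] at ht2
    have hpos : ∀ᶠ ε : ℝ in 𝓝[>] 0, 0 < ε := self_mem_nhdsWithin
    rcases hR' with h | h
    · obtain ⟨ε, h0, h1, h2⟩ := (hpos.and ((ht1.eventually_lt_const hR).and
        (ht2.eventually_lt_const h))).exists
      exact ⟨ε, h0, h1, Or.inl h2⟩
    · obtain ⟨ε, h0, h1, h2⟩ := (hpos.and ((ht1.eventually_lt_const hR).and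
        (ht3.eventually_lt_const h))).exists
      exact ⟨ε, h0, h1, Or.inr h2⟩
  have hev1 : ∀ᶠ F : ℕ in atTop, 1 - (⌊M * F / N⌋₊ : ℝ) / F + ε < R :=
    ((hlim.const_sub 1).add_const ε).eventually_lt_const hε1
  have hev2 : ∀ᶠ F : ℕ in atTop,
      (codedBound K N (subfileProb K ((⌊M * F / N⌋₊ : ℝ) / F)) +
        ε * codedBound K N (fun _ => 1) < R ∨ N * (1 - (⌊M * F / N⌋₊ : ℝ) / F + ε) < R) := by
    rcases hε2 with h | h
    · exact (((((continuous_codedBound_subfileProb K N).tendsto _).comp hlim).add_const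
        _).eventually_lt_const h).mono fun F hF => Or.inl hF
    · exact ((((hlim.const_sub 1).add_const ε).const_mul (N : ℝ)).eventually_lt_const h).mono
        fun F hF => Or.inr hF
  have hbound : ∀ᶠ F : ℕ in atTop, gbdErrorProb N K F M R ≤
      N * 2 ^ K * (1 / (ε ^ 2 * F)) + N * K * (1 / 2) ^ ⌊ε * F⌋₊ := by
    filter_upwards [hev1, hev2, eventually_gt_atTop 0] with F h1 h2 hF
    have hF' : (0 : ℝ) < F := by exact_mod_cast hF
    have hq := floor_le_file_length (F := F) hN hMN
    have hcast : ((F - ⌊M * F / N⌋₊ + ⌊ε * F⌋₊ : ℕ) : ℝ) ≤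
        F * (1 - (⌊M * F / N⌋₊ : ℝ) / F + ε) := by
      push_cast [Nat.cast_sub hq]
      have := Nat.floor_le (a := ε * F) (by positivity)
      have e : F * (1 - (⌊M * F / N⌋₊ : ℝ) / F + ε) = F - ⌊M * F / N⌋₊ + ε * F := by
        field_simp
      rw [e]
      linarith
    refine uniformExp_errorProb_gbdCode_le hq hF (mul_floor_le_cache_size hN hM0.le) hNK hε
      (e := ⌊ε * F⌋₊) ?_ ?_
    · exact Nat.le_floor (hcast.trans (mul_le_mul_of_nonneg_left h1.le hF'.le))
    · refine h2.imp (fun h => ?_) fun h => ?_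
      · exact (mul_lt_mul_of_pos_left h hF').trans (Nat.lt_floor_add_one _)
      · refine Nat.le_floor ?_
        rw [Nat.cast_mul]
        have := mul_le_mul_of_nonneg_left hcast hN'.le
        have := mul_le_mul_of_nonneg_left h.le hF'.le
        linarith
  refine squeeze_zero' (.of_forall fun F => ?_) hbound ?_
  · exact uniformExp_nonneg fun ω => Real.iSup_nonneg fun d => uniformProb_nonneg _
  · have hF : Tendsto (fun F : ℕ => ε * (F : ℝ)) atTop atTop :=
      tendsto_natCast_atTop_atTop.const_mul_atTop hε
    have hF2 : Tendsto (fun F : ℕ => ε ^ 2 * (F : ℝ)) atTop atTop :=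
      tendsto_natCast_atTop_atTop.const_mul_atTop (by positivity)
    have t1 : Tendsto (fun F : ℕ => 1 / (ε ^ 2 * (F : ℝ))) atTop (𝓝 0) :=
      hF2.const_div_atTop 1
    have t2 : Tendsto (fun F : ℕ => (1 / 2 : ℝ) ^ ⌊ε * (F : ℝ)⌋₊) atTop (𝓝 0) :=
      (tendsto_pow_atTop_nhds_zero_of_lt_one (by norm_num) (by norm_num)).comp
        (tendsto_nat_floor_atTop.comp hF)
    simpa using (t1.const_mul ((N : ℝ) * 2 ^ K)).add (t2.const_mul ((N : ℝ) * K))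

theorem achievedByGBD_gbdRate {N K : ℕ} (hN : 1 ≤ N) (hNK : N < K) {M : ℝ} (hM0 : 0 < M)
    (hMN : M ≤ N) : AchievedByGBD N K M (gbdRate N K M) := by
  intro R hR
  obtain ⟨n, rfl⟩ : ∃ n, K = n + 2 := ⟨K - 2, by omega⟩
  have hN' : (1 : ℝ) ≤ N := by exact_mod_cast hN
  have hp0 : 0 < M / N := by positivity
  have hp1 : M / N ≤ 1 := (div_le_one (by linarith)).2 hMN
  rw [gbdRate_eq_min hN hM0 hMN] at hR
  -- The requirement `1 - M/N < R` follows because `1 - M/N` is at most both arguments of the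
  -- minimum.
  refine tendsto_gbdErrorProb hN hNK hM0 hMN (lt_of_le_of_lt (le_min ?_ ?_) hR) (min_lt_iff.1 hR)
  · exact one_sub_le_codedBound hp0 hp1 hN' (by exact_mod_cast hNK)
  · exact le_mul_of_one_le_left (by linarith) hN'

/-- Some realization of the random code has error probability at most the average. -/
theorem AchievedByGBD.achievable {N K : ℕ} (hN : 1 ≤ N) {M R R' : ℝ} (hMN : M ≤ N)
    (h : AchievedByGBD N K M R) (hR : R < R') : Achievable N K M R' := by
  intro ε hε
  obtain ⟨F₀, hF₀⟩ := eventually_atTop.1 ((h R' hR).eventually_lt_const hε)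
  refine ⟨F₀, fun F hF => ?_⟩
  have : Nonempty (Placement N K F ⌊M * (F : ℝ) / (N : ℝ)⌋₊) :=
    nonempty_placement (floor_le_file_length hN hMN)
  obtain ⟨ω, hω⟩ := exists_le_uniformExp fun ω : GBDRandomness N K F M R' =>
    (gbdRateCode ω).errorProb
  exact ⟨gbdRateCode ω, hω.trans_lt (hF₀ F hF)⟩

end Asymptotics

end CodedCaching

end

/-- For `N < K` and cache capacity `0 < M ≤ N`, the GBD scheme achieves the delivery rate
`gbdRate N K M`; in particular every larger rate is achievable at cache capacity `M`. -/
theorem theorem2 (N K : ℕ) (hN : 1 ≤ N) (hNK : N < K) (M : ℝ) (hM0 : 0 < M) (hMN : M ≤ N) :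
    CodedCaching.AchievedByGBD N K M (CodedCaching.gbdRate N K M) ∧
      ∀ R : ℝ, CodedCaching.gbdRate N K M < R → CodedCaching.Achievable N K M R := by
  have h := CodedCaching.achievedByGBD_gbdRate hN hNK hM0 hMN
  exact ⟨h, fun R hR => h.achievable hN hMN hR⟩
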